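/- Let $d\in\mathbb N$. Let $M^1(\mathbb R^n)$ be the Feichtinger algebra: the continuous $f\in L^2(\mathbb R^n)$ whose short-time Fourier transform $V_\varphi f(x,\omega)=\int f(y)\overline{\varphi(y-x)}e^{-2\pi i y\cdot\omega}\,dy$ with $\varphi(t)=e^{-\pi |t|^2}$ is in $L^1(\mathbb R^{2n})$, with norm $\|V_\varphi f\|_{L^1}$. Let $M^\infty(\mathbb R^n)=(M^1(\mathbb R^n))'$, with the bracket $\langle u,f\rangle$ extending the inner product $\int u\bar f$ of $L^2$ (linear in $u\in M^\infty$, conjugate-linear in $f\in M^1$), and put $\langle\overline{u},f\rangle=\overline{\langle u,\overline f\rangle}$; $u$ is real if $\overline u=u$. For a real matrix $A=\begin{pmatrix}A_{11}&A_{12}\\A_{21}&A_{22}\end{pmatrix}\in \mathrm{GL}(2d,\mathbb R)$ with $d\times d$ blocks and $f,g\in M^1(\mathbb R^d)$ let $$\mathcal B_A(f,g)(x,\omega)=\int_{\mathbb R^d}e^{-2\pi i y\cdot\omega}f(A_{11}x+A_{12}y)\,\overline{g(A_{21}x+A_{22}y)}\,dy ,$$ and for $\sigma\in M^\infty(\mathbb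 R^{2d})$ let $\sigma^A:M^1(\mathbb R^d)\to M^\infty(\mathbb R^d)$ be the continuous linear operator with $\langle\sigma^Af,g\rangle=\langle\sigma,\mathcal B_A(g,f)\rangle$ for all $f,g\in M^1(\mathbb R^d)$. The adjoint $T^*:M^1\to M^\infty$ of a continuous linear operator $T:M^1\to M^\infty$ is given by $\langle T^*f,g\rangle=\overline{\langle Tg,f\rangle}$, and $T$ is self-adjoint if $T^*=T$. **Proposition.** Let $A\in \mathrm{GL}(2d,\mathbb R)$ and $$B=\tilde I A\,\mathcal I_2=\begin{pmatrix}0&I\\I&0\end{pmatrix}A\begin{pmatrix}I&0\\0&-I\end{pmatrix}=\begin{pmatrix}A_{21}&-A_{22}\\A_{11}&-A_{12}\end{pmatrix}\in\mathrm{GL}(2d,\mathbb R).$$ 1. For every $\sigma\in M^\infty(\mathbb R^{2d})$ the operators $\sigma^A$ and $\overline{\sigma}^{\,B}$ are well defined, and $(\sigma^A)^*=\rho^B$ with $\rho=\overline\sigma$. 2. $B=A$ if and only if $A_{21}=A_{11}$ and $A_{12}=-A_{22}$. These two equalities hold if and only if the equivalence "$\sigma^A$ is self-adjoint $\Leftrightarrow$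 $\sigma$ is real" holds for every symbol $\sigma\in M^\infty(\mathbb R^{2d})$; they also hold if and only if $\sigma^A$ is self-adjoint for every real symbol $\sigma\in M^\infty(\mathbb R^{2d})$. -/

import Mathlib

noncomputable section

open MeasureTheory

/-! ### The Feichtinger algebra and its (conjugate-linear) dual -/

/-- The Gaussian window `t ↦ exp (-π |t|²)` on `ℝ^ι`. -/
def gaussWindow {ι : Type*} [Fintype ι] (t : EuclideanSpace ℝ ι) : ℂ :=
  ((Real.exp (-(Real.pi * ‖t‖ ^ 2)) : ℝ) : ℂ)

/-- The short-time Fourier transform with Gaussian window `φ`,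
`V_φ f (x, ω) = ∫ f(y) conj(φ(y - x)) exp(-2πi y·ω) dy`, as a function of `(x, ω)`. -/
def stft {ι : Type*} [Fintype ι] (f : EuclideanSpace ℝ ι → ℂ)
    (p : EuclideanSpace ℝ ι × EuclideanSpace ℝ ι) : ℂ :=
  ∫ y : EuclideanSpace ℝ ι,
    f y * starRingEnd ℂ (gaussWindow (y - p.1)) *
      Complex.exp (((-2 * Real.pi * inner ℝ y p.2 : ℝ) : ℂ) * Complex.I)

/-- `f` belongs to the modulation space `M¹(ℝ^ι)`: it is square integrable with integrable
short-time Fourier transform. Every class in `M¹` has exactly one continuous representative;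
elements are functions, so we ask for that one. -/
structure MemM1 {ι : Type*} [Fintype ι] (f : EuclideanSpace ℝ ι → ℂ) : Prop where
  continuous : Continuous f
  memLp : MemLp f 2 volume
  integrable_stft : Integrable (stft f) volume

theorem continuous_gaussWindow {ι : Type*} [Fintype ι] :
    Continuous (gaussWindow : EuclideanSpace ℝ ι → ℂ) := by
  unfold gaussWindow
  fun_prop

theorem memLp_gaussWindow {ι : Type*} [Fintype ι] :
    MemLp (gaussWindow : EuclideanSpace ℝ ι → ℂ) 2 volume := by
  rw [memLp_two_iff_integrable_sq_norm continuous_gaussWindow.aestronglyMeasurable]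
  have h := (GaussianFourier.integrable_cexp_neg_mul_sq_norm_add
    (V := EuclideanSpace ℝ ι) (b := ((2 * Real.pi : ℝ) : ℂ))
    (by rw [Complex.ofReal_re]; positivity) 0 0).norm
  refine h.congr (Filter.Eventually.of_forall fun t => ?_)
  simp only [gaussWindow, Complex.norm_real, Real.norm_eq_abs, abs_of_pos (Real.exp_pos _),
    Complex.norm_exp, zero_mul, add_zero]
  rw [← Real.exp_nat_mul]
  congr 1
  rw [← Complex.ofReal_neg, ← Complex.ofReal_pow, ← Complex.ofReal_mul, Complex.ofReal_re]
  push_cast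
  ring

theorem integrable_stft_integrand {ι : Type*} [Fintype ι] {f : EuclideanSpace ℝ ι → ℂ}
    (hf : MemLp f 2 volume) (p : EuclideanSpace ℝ ι × EuclideanSpace ℝ ι) :
    Integrable (fun y : EuclideanSpace ℝ ι => f y * starRingEnd ℂ (gaussWindow (y - p.1)) *
      Complex.exp (((-2 * Real.pi * inner ℝ y p.2 : ℝ) : ℂ) * Complex.I)) volume := by
  have hg : MemLp (fun y : EuclideanSpace ℝ ι => starRingEnd ℂ (gaussWindow (y - p.1))) 2 volume :=
    (memLp_gaussWindow.comp_measurePreserving (measurePreserving_sub_right volume p.1)).star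
  have h := hf.integrable_mul hg
  refine h.mul_bdd (c := 1) ?_ (Filter.Eventually.of_forall fun y => ?_)
  · exact Continuous.aestronglyMeasurable (by fun_prop)
  · rw [Complex.norm_exp_ofReal_mul_I]

theorem stft_add {ι : Type*} [Fintype ι] {f g : EuclideanSpace ℝ ι → ℂ}
    (hf : MemLp f 2 volume) (hg : MemLp g 2 volume) : stft (f + g) = stft f + stft g := by
  funext p
  simp only [stft, Pi.add_apply, add_mul]
  exact integral_add (integrable_stft_integrand hf p) (integrable_stft_integrand hg p)

theorem stft_smul {ι : Type*} [Fintype ι] (c : ℂ) (f : EuclideanSpace ℝ ι → ℂ) :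
    stft (c • f) = c • stft f := by
  funext p
  simp only [stft, Pi.smul_apply, smul_eq_mul, mul_assoc]
  exact integral_const_mul c _

/-- Complex conjugation of functions corresponds to `(x, ω) ↦ conj (V_φ f (x, -ω))`. -/
theorem stft_conj {ι : Type*} [Fintype ι] (f : EuclideanSpace ℝ ι → ℂ)
    (p : EuclideanSpace ℝ ι × EuclideanSpace ℝ ι) :
    stft (fun t => starRingEnd ℂ (f t)) p = starRingEnd ℂ (stft f (p.1, -p.2)) := by
  simp only [stft]
  rw [← integral_conj]
  refine integral_congr_ae (Filter.Eventually.of_forall fun y => ?_)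
  beta_reduce
  rw [map_mul, map_mul, Complex.conj_conj, ← Complex.exp_conj, map_mul, Complex.conj_I,
    Complex.conj_ofReal, inner_neg_right]
  simp only [gaussWindow, Complex.conj_ofReal]
  congr 2
  push_cast
  ring

theorem measurePreserving_neg_snd {ι : Type*} [Fintype ι] :
    MeasurePreserving
      (fun p : EuclideanSpace ℝ ι × EuclideanSpace ℝ ι => (p.1, -p.2)) volume volume :=
  (MeasurePreserving.id volume).prod (Measure.measurePreserving_neg volume)

theorem measurableEmbedding_neg_snd {ι : Type*} [Fintype ι] :
    MeasurableEmbedding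
      (fun p : EuclideanSpace ℝ ι × EuclideanSpace ℝ ι => (p.1, -p.2)) :=
  ((MeasurableEquiv.refl _).prodCongr (MeasurableEquiv.neg _)).measurableEmbedding

theorem MemM1.add {ι : Type*} [Fintype ι] {f g : EuclideanSpace ℝ ι → ℂ}
    (hf : MemM1 f) (hg : MemM1 g) : MemM1 (f + g) where
  continuous := hf.continuous.add hg.continuous
  memLp := hf.memLp.add hg.memLp
  integrable_stft := by
    rw [stft_add hf.memLp hg.memLp]
    exact hf.integrable_stft.add hg.integrable_stft

theorem MemM1.smul {ι : Type*} [Fintype ι] (c : ℂ) {f : EuclideanSpace ℝ ι → ℂ}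
    (hf : MemM1 f) : MemM1 (c • f) where
  continuous := hf.continuous.const_smul c
  memLp := hf.memLp.const_smul c
  integrable_stft := by
    rw [stft_smul]
    exact hf.integrable_stft.smul c

theorem MemM1.zero {ι : Type*} [Fintype ι] : MemM1 (0 : EuclideanSpace ℝ ι → ℂ) where
  continuous := continuous_const
  memLp := MemLp.zero
  integrable_stft := by
    have h : stft (0 : EuclideanSpace ℝ ι → ℂ) = 0 := by
      funext p
      simp [stft]
    rw [h]
    exact integrable_zero _ _ _

theorem MemM1.conj {ι : Type*} [Fintype ι] {f : EuclideanSpace ℝ ι → ℂ}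
    (hf : MemM1 f) : MemM1 (fun t => starRingEnd ℂ (f t)) where
  continuous := Complex.continuous_conj.comp hf.continuous
  memLp := hf.memLp.star
  integrable_stft := by
    have h := (measurePreserving_neg_snd.integrable_comp_emb measurableEmbedding_neg_snd).2
      hf.integrable_stft
    have h2 := (Complex.conjCLE : ℂ →L[ℝ] ℂ).integrable_comp h
    refine h2.congr (Filter.Eventually.of_forall fun p => ?_)
    exact (stft_conj f p).symm

/-- `M¹(ℝ^ι)` as a linear space of functions. -/
def m1Submodule (ι : Type*) [Fintype ι] : Submodule ℂ (EuclideanSpace ℝ ι → ℂ) where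
  carrier := {f | MemM1 f}
  add_mem' := fun hf hg => MemM1.add hf hg
  zero_mem' := MemM1.zero
  smul_mem' := fun c _ hf => MemM1.smul c hf

/-- The Feichtinger algebra `M¹(ℝ^ι)`. It gets its own type so that its topology is that of the
norm `‖V_φ f‖_{L¹}`, and not that of pointwise convergence. -/
def M1 (ι : Type*) [Fintype ι] : Type _ := m1Submodule ι

namespace M1

variable {ι : Type*} [Fintype ι]

instance : AddCommGroup (M1 ι) := inferInstanceAs (AddCommGroup (m1Submodule ι))

instance : Module ℂ (M1 ι) := inferInstanceAs (Module ℂ (m1Submodule ι))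

/-- The function underlying an element of `M¹`. -/
def toFun (f : M1 ι) : EuclideanSpace ℝ ι → ℂ := f.1

/-- A function with the defining properties of `M¹`, as an element of `M¹`. -/
def mk (f : EuclideanSpace ℝ ι → ℂ) (hf : MemM1 f) : M1 ι := ⟨f, hf⟩

theorem memM1 (f : M1 ι) : MemM1 f.toFun := f.2

theorem ext' {f g : M1 ι} (h : f.toFun = g.toFun) : f = g := Subtype.ext h

/-- The norm `‖f‖ = ‖V_φ f‖_{L¹}`. -/
instance : Norm (M1 ι) := ⟨fun f => ∫ p, ‖stft f.toFun p‖⟩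

theorem norm_def (f : M1 ι) : ‖f‖ = ∫ p, ‖stft f.toFun p‖ := rfl

theorem core : SeminormedSpace.Core ℂ (M1 ι) where
  norm_nonneg f := integral_nonneg fun _ => norm_nonneg _
  norm_smul c f := by
    have h : (c • f).toFun = c • f.toFun := rfl
    simp only [norm_def, h, stft_smul, Pi.smul_apply, norm_smul]
    exact integral_const_mul _ _
  norm_triangle f g := by
    have h : (f + g).toFun = f.toFun + g.toFun := rfl
    simp only [norm_def, h, stft_add f.memM1.memLp g.memM1.memLp]
    rw [← integral_add f.memM1.integrable_stft.norm g.memM1.integrable_stft.norm]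
    exact integral_mono (f.memM1.integrable_stft.add g.memM1.integrable_stft).norm
      (f.memM1.integrable_stft.norm.add g.memM1.integrable_stft.norm)
      fun p => norm_add_le _ _

instance : SeminormedAddCommGroup (M1 ι) := SeminormedAddCommGroup.ofCore core

instance : NormedSpace ℂ (M1 ι) where
  norm_smul_le c f := (core.norm_smul c f).le

/-- Complex conjugation `f ↦ conj f` on `M¹`. -/
def conj (f : M1 ι) : M1 ι := mk (fun t => starRingEnd ℂ (f.toFun t)) f.memM1.conj

theorem norm_conj (f : M1 ι) : ‖f.conj‖ = ‖f‖ := by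
  have h : ∀ p, ‖stft f.conj.toFun p‖ = ‖stft f.toFun (p.1, -p.2)‖ := fun p => by
    have := stft_conj f.toFun p
    change ‖stft (fun t => starRingEnd ℂ (f.toFun t)) p‖ = _
    rw [this, RCLike.norm_conj]
  simp only [norm_def, h]
  exact measurePreserving_neg_snd.integral_comp measurableEmbedding_neg_snd
    fun p => ‖stft f.toFun p‖

end M1

/-- The modulation space `M^∞(ℝ^ι) = (M¹(ℝ^ι))'`: the bounded functionals `u` on `M¹`, which we
write as `g ↦ ⟨u, g⟩`. The bracket extends the inner product `⟨f, g⟩ = ∫ f conj(g)` of `L²`,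
so it is linear in `u` and conjugate-linear in `g`. -/
abbrev MInfty (ι : Type*) [Fintype ι] : Type _ := M1 ι →L⋆[ℂ] ℂ

/-- The complex conjugate of `σ ∈ M^∞`: `⟨conj σ, F⟩ = conj ⟨σ, conj F⟩`. -/
def MInfty.conj {ι : Type*} [Fintype ι] (σ : MInfty ι) : MInfty ι :=
  LinearMap.mkContinuous
    { toFun := fun F => starRingEnd ℂ (σ F.conj)
      map_add' := fun F G => by
        have h : M1.conj (F + G) = M1.conj F + M1.conj G :=
          M1.ext' (funext fun t => map_add (starRingEnd ℂ) (F.toFun t) (G.toFun t))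
        rw [h, map_add, map_add]
      map_smul' := fun c F => by
        have h : (c • F).conj = starRingEnd ℂ c • F.conj :=
          M1.ext' (funext fun t => map_mul (starRingEnd ℂ) c (F.toFun t))
        rw [h, map_smulₛₗ, smul_eq_mul, smul_eq_mul, map_mul, Complex.conj_conj] }
    ‖σ‖ fun F => by
      refine (RCLike.norm_conj _).trans_le ((σ.le_opNorm _).trans_eq ?_)
      rw [M1.norm_conj]

/-! ### Matrix-Wigner distributions and the associated pseudodifferential operators -/

/-- The space `ℝ^d`. -/
abbrev Pos (d : ℕ) : Type := EuclideanSpace ℝ (Fin d)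

/-- The space `ℝ^{2d}`, with coordinates split in two groups of `d`. -/
abbrev Phase (d : ℕ) : Type := EuclideanSpace ℝ (Fin d ⊕ Fin d)

/-- The first component `x` of `(x, ω) ∈ ℝ^{2d}`. -/
def Phase.fst {d : ℕ} (z : Phase d) : Pos d := WithLp.toLp 2 fun i => z (Sum.inl i)

/-- The second component `ω` of `(x, ω) ∈ ℝ^{2d}`. -/
def Phase.snd {d : ℕ} (z : Phase d) : Pos d := WithLp.toLp 2 fun i => z (Sum.inr i)

/-- A real `d × d` matrix acting on `ℝ^d`. -/
def matAct {d : ℕ} (P : Matrix (Fin d) (Fin d) ℝ) (x : Pos d) : Pos d :=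
  WithLp.toLp 2 (P.mulVec x.ofLp)

/-- The matrix-Wigner distribution
`B_A(f, g)(x, ω) = ∫ exp(-2πi y·ω) f(A₁₁x + A₁₂y) conj(g(A₂₁x + A₂₂y)) dy`. -/
def matrixWigner {d : ℕ} (A : Matrix (Fin d ⊕ Fin d) (Fin d ⊕ Fin d) ℝ)
    (f g : Pos d → ℂ) (z : Phase d) : ℂ :=
  ∫ y : Pos d,
    Complex.exp (((-2 * Real.pi * inner ℝ y z.snd : ℝ) : ℂ) * Complex.I) *
      f (matAct A.toBlocks₁₁ z.fst + matAct A.toBlocks₁₂ y) *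
      starRingEnd ℂ (g (matAct A.toBlocks₂₁ z.fst + matAct A.toBlocks₂₂ y))

/-- Continuous linear operators `M¹(ℝ^d) → M^∞(ℝ^d)`; `T f g` is the bracket `⟨T f, g⟩`. -/
abbrev M1Operator (d : ℕ) : Type := M1 (Fin d) →L[ℂ] MInfty (Fin d)

/-- `T = σ^A`, that is, `⟨T f, g⟩ = ⟨σ, B_A(g, f)⟩` for all `f, g ∈ M¹(ℝ^d)`; this includes that
`B_A(g, f)` belongs to `M¹(ℝ^{2d})`, so that the right-hand side makes sense. -/
def IsQuantization {d : ℕ} (A : Matrix (Fin d ⊕ Fin d) (Fin d ⊕ Fin d) ℝ)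
    (σ : MInfty (Fin d ⊕ Fin d)) (T : M1Operator d) : Prop :=
  ∀ f g : M1 (Fin d), ∃ h : MemM1 (matrixWigner A g.toFun f.toFun),
    T f g = σ (M1.mk (matrixWigner A g.toFun f.toFun) h)

theorem IsQuantization.unique {d : ℕ} {A : Matrix (Fin d ⊕ Fin d) (Fin d ⊕ Fin d) ℝ}
    {σ : MInfty (Fin d ⊕ Fin d)} {S T : M1Operator d}
    (hS : IsQuantization A σ S) (hT : IsQuantization A σ T) : S = T := by
  ext f g
  obtain ⟨_, h1⟩ := hS f g
  obtain ⟨_, h2⟩ := hT f g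
  rw [h1, h2]

open Classical in
/-- The operator `σ^A` with symbol `σ` associated with `B_A`: the only operator with
`IsQuantization A σ` (and `0` if there were none, which never happens for invertible `A`). -/
def quantize {d : ℕ} (A : Matrix (Fin d ⊕ Fin d) (Fin d ⊕ Fin d) ℝ)
    (σ : MInfty (Fin d ⊕ Fin d)) : M1Operator d :=
  if h : ∃ T : M1Operator d, IsQuantization A σ T then h.choose else 0

/-- The adjoint `T* : M¹ → M^∞` of `T : M¹ → M^∞`, with
`⟨T* f, g⟩ = ⟨f, T g⟩ = conj ⟨T g, f⟩`. -/
def M1Operator.adj {d : ℕ} (T : M1Operator d) : M1Operator d :=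
  LinearMap.mkContinuous₂
    (LinearMap.mk₂'ₛₗ (RingHom.id ℂ) (starRingEnd ℂ)
      (fun f g => starRingEnd ℂ (T g f))
      (fun f₁ f₂ g => by rw [map_add, map_add])
      (fun c f g => by
        rw [map_smulₛₗ, smul_eq_mul, map_mul, Complex.conj_conj, RingHom.id_apply, smul_eq_mul])
      (fun f g₁ g₂ => by rw [map_add, add_apply, map_add])
      (fun c f g => by
        rw [map_smul, smul_apply, smul_eq_mul, map_mul, smul_eq_mul]))
    ‖T‖ (fun f g => by
      refine (RCLike.norm_conj _).trans_le ((T.le_opNorm₂ g f).trans_eq ?_)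
      ring)

/-- The swap matrix `Ĩ = [[0, I], [I, 0]]`. -/
def swapMatrix (d : ℕ) : Matrix (Fin d ⊕ Fin d) (Fin d ⊕ Fin d) ℝ :=
  Matrix.fromBlocks 0 1 1 0

/-- The matrix `I₂ = [[I, 0], [0, -I]]`. -/
def reflMatrix (d : ℕ) : Matrix (Fin d ⊕ Fin d) (Fin d ⊕ Fin d) ℝ :=
  Matrix.fromBlocks 1 0 0 (-1)

end

noncomputable section

open MeasureTheory Filter Topology

/-! The adjoint formula is a symmetry of the integral: conjugating `B_A(f, g)` and substituting `y ↦
-y` exchanges the rows of `A` and negates its second column, so `B_A(f, g)` is the conjugate of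
`B_B(g, f)` (`conj_matrixWigner_fromBlocks`). Inserting this in the definition of the adjoint moves
the conjugation onto the symbol.

The analytic work lies in three facts about `B_A`, all read off from time-frequency shifts `π(r)` of
the Gaussian `φ`. The form `B_A(π(p)φ, π(q)φ)` is a unimodular multiple of a shift of the single
function `B_A(φ, φ)` (`matrixWigner_tfShift`), whose short-time Fourier transform has Gaussian decay
(`exists_norm_stft_wignerGauss_le`). Boundedness: expanding `f` and `g` in shifts of `φ` writes
`B_A(f, g)` as an integrable superposition of shifts of `B_A(φ, φ)`, so `B_A` maps `M¹ × M¹`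
boundedly to `M¹` (`memM1_matrixWigner`) and `σ^A` exists. Injectivity of `σ ↦ σ^A`: every shift of
`B_A(φ, φ)` occurs, and a functional vanishing on all of them is zero (`MInfty.eq_zero_of_tfShift`).
If `B = A`, then `(σ^A)*` has symbol `conj σ` for the same `A`, and injectivity gives the
equivalence with `σ` being real. Rigidity: `B_A` determines `A`, because the location of `B_A(π(p)φ,
π(q)φ)` in phase space does (`eq_of_matrixWigner_eq`). Point evaluations are real symbols; if they
all give self-adjoint operators, then `B_A(f, g) = B_B(f, g)` pointwise, whence `A = B`. -/

/-- The unimodular number `exp (i x)`. -/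
def unitExp (x : ℝ) : ℂ := Complex.exp ((x : ℂ) * Complex.I)

theorem unitExp_add (x y : ℝ) : unitExp (x + y) = unitExp x * unitExp y := by
  rw [unitExp, unitExp, unitExp, ← Complex.exp_add]
  push_cast
  ring_nf

@[simp] theorem unitExp_zero : unitExp 0 = 1 := by simp [unitExp]

@[simp] theorem norm_unitExp (x : ℝ) : ‖unitExp x‖ = 1 := Complex.norm_exp_ofReal_mul_I x

theorem conj_unitExp (x : ℝ) : starRingEnd ℂ (unitExp x) = unitExp (-x) := by
  rw [unitExp, unitExp, ← Complex.exp_conj, map_mul, Complex.conj_I, Complex.conj_ofReal]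
  push_cast
  ring_nf

@[fun_prop] theorem continuous_unitExp : Continuous unitExp := by
  unfold unitExp
  fun_prop

attribute [fun_prop] continuous_gaussWindow

/-! ### The Gaussian window and time-frequency shifts -/

section Window

variable {ι : Type*} [Fintype ι]

theorem norm_gaussWindow (t : EuclideanSpace ℝ ι) :
    ‖gaussWindow t‖ = Real.exp (-(Real.pi * ‖t‖ ^ 2)) := by
  rw [gaussWindow, Complex.norm_real, Real.norm_eq_abs, abs_of_pos (Real.exp_pos _)]

theorem norm_gaussWindow_le_one (t : EuclideanSpace ℝ ι) : ‖gaussWindow t‖ ≤ 1 := by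
  rw [norm_gaussWindow, Real.exp_le_one_iff]
  have : 0 ≤ Real.pi * ‖t‖ ^ 2 := by positivity
  linarith

@[simp] theorem conj_gaussWindow (t : EuclideanSpace ℝ ι) :
    starRingEnd ℂ (gaussWindow t) = gaussWindow t := Complex.conj_ofReal _

theorem integrable_exp_neg_mul_sq_norm {ε : ℝ} (hε : 0 < ε) :
    Integrable fun t : EuclideanSpace ℝ ι => Real.exp (-(ε * ‖t‖ ^ 2)) := by
  have h := (GaussianFourier.integrable_cexp_neg_mul_sq_norm_add
    (V := EuclideanSpace ℝ ι) (b := (ε : ℂ)) (by simpa using hε) 0 0).norm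
  refine h.congr (Eventually.of_forall fun t => ?_)
  simp only [Complex.norm_exp, zero_mul, add_zero]
  congr 1
  rw [← Complex.ofReal_neg, ← Complex.ofReal_pow, ← Complex.ofReal_mul, Complex.ofReal_re]
  ring

theorem integrable_gaussWindow : Integrable (gaussWindow : EuclideanSpace ℝ ι → ℂ) := by
  rw [← integrable_norm_iff continuous_gaussWindow.aestronglyMeasurable]
  exact (integrable_exp_neg_mul_sq_norm Real.pi_pos).congr
    (Eventually.of_forall fun t => (norm_gaussWindow t).symm)

/-- The normalization of the exponent by `π` makes the Gaussian a fixed point of the Fourier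
transform; hence a partial Fourier transform keeps the same window. -/
theorem integral_gaussWindow_mul_unitExp (w : EuclideanSpace ℝ ι) :
    ∫ t : EuclideanSpace ℝ ι, gaussWindow t * unitExp (-2 * Real.pi * inner ℝ t w)
      = gaussWindow w := by
  have h := fourier_gaussian_innerProductSpace (V := EuclideanSpace ℝ ι) (b := (Real.pi : ℂ))
    (by simpa using Real.pi_pos) w
  rw [Real.fourier_eq', div_self (by exact_mod_cast Real.pi_ne_zero), Complex.one_cpow,
    one_mul] at h
  calc _ = _ := integral_congr_ae (Eventually.of_forall fun t => ?_)
    _ = _ := h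
    _ = _ := ?_
  · simp only [gaussWindow, unitExp, smul_eq_mul]
    rw [mul_comm]
    congr 1
    push_cast
    ring_nf
  · have : (Real.pi : ℂ) ≠ 0 := by exact_mod_cast Real.pi_ne_zero
    rw [gaussWindow]
    push_cast
    congr 1
    field_simp

theorem stft_eq (f : EuclideanSpace ℝ ι → ℂ) (p : EuclideanSpace ℝ ι × EuclideanSpace ℝ ι) :
    stft f p = ∫ y, f y * gaussWindow (y - p.1) * unitExp (-2 * Real.pi * inner ℝ y p.2) := by
  simp only [stft, conj_gaussWindow, unitExp]

/-- The time-frequency shift `t ↦ exp (2πi t·r₂) G (t - r₁)`. -/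
def tfShift (r : EuclideanSpace ℝ ι × EuclideanSpace ℝ ι) (G : EuclideanSpace ℝ ι → ℂ)
    (t : EuclideanSpace ℝ ι) : ℂ :=
  unitExp (2 * Real.pi * inner ℝ t r.2) * G (t - r.1)

theorem norm_tfShift (r : EuclideanSpace ℝ ι × EuclideanSpace ℝ ι) (G : EuclideanSpace ℝ ι → ℂ)
    (t : EuclideanSpace ℝ ι) : ‖tfShift r G t‖ = ‖G (t - r.1)‖ := by
  rw [tfShift, norm_mul, norm_unitExp, one_mul]

/-- Covariance, from the translation `y ↦ y + r.1`: up to a phase, a time-frequency shift translates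
the short-time Fourier transform. The norm of `M¹` is therefore shift invariant. -/
theorem stft_tfShift (r s : EuclideanSpace ℝ ι × EuclideanSpace ℝ ι)
    (G : EuclideanSpace ℝ ι → ℂ) :
    stft (tfShift r G) s = unitExp (-2 * Real.pi * inner ℝ r.1 (s.2 - r.2)) * stft G (s - r) := by
  rw [stft_eq, stft_eq, ← integral_const_mul,
    ← integral_add_right_eq_self (μ := volume) _ r.1]
  refine integral_congr_ae (Eventually.of_forall fun y => ?_)
  have h : unitExp (2 * Real.pi * inner ℝ (y + r.1) r.2) *
        unitExp (-2 * Real.pi * inner ℝ (y + r.1) s.2) =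
      unitExp (-2 * Real.pi * inner ℝ r.1 (s.2 - r.2)) *
        unitExp (-2 * Real.pi * inner ℝ y (s.2 - r.2)) := by
    rw [← unitExp_add, ← unitExp_add]
    congr 1
    simp only [inner_add_left, inner_sub_right]
    ring
  have h2 : y - (s.1 - r.1) = y + r.1 - s.1 := by abel
  simp only [tfShift, Prod.fst_sub, Prod.snd_sub, h2, add_sub_cancel_right]
  linear_combination (G y * gaussWindow (y + r.1 - s.1)) * h

theorem norm_stft_tfShift (r s : EuclideanSpace ℝ ι × EuclideanSpace ℝ ι)
    (G : EuclideanSpace ℝ ι → ℂ) : ‖stft (tfShift r G) s‖ = ‖stft G (s - r)‖ := by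
  rw [stft_tfShift, norm_mul, norm_unitExp, one_mul]

theorem continuous_stft {G : EuclideanSpace ℝ ι → ℂ} (hG : Continuous G) {C : ℝ}
    (hC : ∀ t, ‖G t‖ ≤ C) : Continuous (stft G) := by
  -- Centring the window at the origin makes the dominating function independent of `p`.
  have h : stft G = fun p => ∫ y, G (y + p.1) * gaussWindow y *
      unitExp (-2 * Real.pi * inner ℝ (y + p.1) p.2) := by
    funext p
    rw [stft_eq, ← integral_add_right_eq_self (μ := volume) _ p.1]
    simp only [add_sub_cancel_right]
  rw [h]
  refine continuous_of_dominated (bound := fun y => C * ‖gaussWindow y‖) (fun p => ?_) (fun p => ?_)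
    (integrable_gaussWindow.norm.const_mul C) (Eventually.of_forall fun y => ?_)
  · exact Continuous.aestronglyMeasurable (by fun_prop)
  · refine Eventually.of_forall fun y => ?_
    rw [norm_mul, norm_mul, norm_unitExp, mul_one]
    gcongr
    exact hC _
  · fun_prop

end Window

/-! ### Inversion formula and superpositions of time-frequency shifts -/

section Modulation

variable {ι : Type*} [Fintype ι]

instance isAddLeftInvariant_volume_prod : Measure.IsAddLeftInvariant
    (volume : Measure (EuclideanSpace ℝ ι × EuclideanSpace ℝ ι)) := by
  rw [Measure.volume_eq_prod]
  infer_instance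

/-- The constant `∫ φ²` of the Gaussian window. -/
def gaussNormSq (ι : Type*) [Fintype ι] : ℝ :=
  ∫ t : EuclideanSpace ℝ ι, Real.exp (-(2 * Real.pi * ‖t‖ ^ 2))

theorem gaussNormSq_pos : 0 < gaussNormSq ι :=
  integral_exp_pos (integrable_exp_neg_mul_sq_norm (by positivity))

theorem integral_gaussWindow_mul_self :
    ∫ t : EuclideanSpace ℝ ι, gaussWindow t * gaussWindow t = (gaussNormSq ι : ℂ) := by
  rw [gaussNormSq, ← integral_complex_ofReal]
  refine integral_congr_ae (Eventually.of_forall fun t => ?_)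
  simp only [gaussWindow]
  rw [← Complex.ofReal_mul, ← Real.exp_add]
  ring_nf

theorem continuous_tfShift {G : EuclideanSpace ℝ ι → ℂ} (hG : Continuous G) :
    Continuous fun q : (EuclideanSpace ℝ ι × EuclideanSpace ℝ ι) × EuclideanSpace ℝ ι =>
      tfShift q.1 G q.2 := by
  unfold tfShift
  fun_prop

theorem Continuous.tfShift {G : EuclideanSpace ℝ ι → ℂ} (hG : Continuous G)
    (r : EuclideanSpace ℝ ι × EuclideanSpace ℝ ι) : Continuous (tfShift r G) := by
  unfold _root_.tfShift
  fun_prop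

theorem measurable_tfShift {X : Type*} [MeasurableSpace X]
    {r : X → EuclideanSpace ℝ ι × EuclideanSpace ℝ ι} (hr : Measurable r)
    {G : EuclideanSpace ℝ ι → ℂ} (hG : Continuous G) :
    Measurable fun q : X × EuclideanSpace ℝ ι => tfShift (r q.1) G q.2 := by
  have h1 : Measurable fun q : X × EuclideanSpace ℝ ι => (r q.1, q.2) :=
    (hr.comp measurable_fst).prodMk measurable_snd
  have h2 : Measurable fun q : (EuclideanSpace ℝ ι × EuclideanSpace ℝ ι) × EuclideanSpace ℝ ι =>
      tfShift q.1 G q.2 := (continuous_tfShift hG).measurable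
  have h3 := h2.comp h1
  exact h3

/-- For fixed `x`, the frequency integral is Fourier inversion for `y ↦ f y * φ (y - x)`, valid for
almost every `x` because `stft f` is integrable. What remains is a convolution-type integral in `x`,
giving the constant `∫ φ γ`. The synthesis window `γ` may differ from `φ`; the density argument
needs this. -/
theorem stft_inversion {f γ : EuclideanSpace ℝ ι → ℂ} (hf : Continuous f)
    (hfi : ∀ x, Integrable fun y => f y * gaussWindow (y - x)) (hs : Integrable (stft f))
    (hγ : Continuous γ) {C : ℝ} (hC : ∀ t, ‖γ t‖ ≤ C) (t : EuclideanSpace ℝ ι) :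
    ∫ r, stft f r * tfShift r γ t = f t * ∫ y, gaussWindow y * γ y := by
  have hint : Integrable fun r => stft f r * tfShift r γ t := by
    refine hs.mul_bdd (c := C) ?_ (Eventually.of_forall fun r => ?_)
    · exact ((continuous_tfShift hγ).comp
        (by fun_prop : Continuous fun r => (r, t))).aestronglyMeasurable
    · rw [norm_tfShift]
      exact hC _
  rw [Measure.volume_eq_prod] at hint hs ⊢
  rw [integral_prod _ hint]
  have key : ∀ᵐ x : EuclideanSpace ℝ ι, ∫ w, stft f (x, w) * tfShift (x, w) γ t =
      f t * (gaussWindow (t - x) * γ (t - x)) := by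
    filter_upwards [hs.prod_right_ae] with x hx
    have hF : FourierTransform.fourier (fun y => f y * gaussWindow (y - x)) =
        fun w => stft f (x, w) := by
      funext w
      rw [Real.fourier_eq', stft_eq]
      refine integral_congr_ae (Eventually.of_forall fun y => ?_)
      simp only [unitExp, smul_eq_mul]
      ring
    have hinv := Continuous.fourierInv_fourier_eq (f := fun y => f y * gaussWindow (y - x))
      (by fun_prop) (hfi x) (by rw [hF]; exact hx)
    have hinv := congrFun hinv t
    rw [hF, Real.fourierInv_eq'] at hinv
    calc _ = ∫ w, (Complex.exp (((2 * Real.pi * inner ℝ w t : ℝ) : ℂ) * Complex.I) •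
          stft f (x, w)) * γ (t - x) := by
          refine integral_congr_ae (Eventually.of_forall fun w => ?_)
          simp only [tfShift, unitExp, smul_eq_mul, real_inner_comm]
          ring
      _ = _ := by
          rw [integral_mul_const, hinv]
          ring
  rw [integral_congr_ae key, integral_const_mul,
    integral_sub_left_eq_self (fun y => gaussWindow y * γ y) volume t]

theorem MemM1.integrable_mul_gaussWindow {f : EuclideanSpace ℝ ι → ℂ} (hf : MemM1 f)
    (x : EuclideanSpace ℝ ι) : Integrable fun y => f y * gaussWindow (y - x) := by
  simpa using integrable_stft_integrand hf.memLp (x, 0)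

theorem integrable_bounded_mul_gaussWindow {G : EuclideanSpace ℝ ι → ℂ} (hG : Continuous G)
    {C : ℝ} (hC : ∀ t, ‖G t‖ ≤ C) (x : EuclideanSpace ℝ ι) :
    Integrable fun y => G y * gaussWindow (y - x) :=
  (integrable_gaussWindow.comp_sub_right x).bdd_mul hG.aestronglyMeasurable
    (Eventually.of_forall hC)

/-- Expansion of `f ∈ M¹` into time-frequency shifts of the Gaussian. -/
theorem MemM1.expansion {f : EuclideanSpace ℝ ι → ℂ} (hf : MemM1 f) (t : EuclideanSpace ℝ ι) :
    ∫ r, stft f r * tfShift r gaussWindow t = f t * (gaussNormSq ι : ℂ) := by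
  rw [stft_inversion hf.continuous hf.integrable_mul_gaussWindow hf.integrable_stft
    continuous_gaussWindow norm_gaussWindow_le_one, integral_gaussWindow_mul_self]

/-- Every shift of the Gaussian is bounded by 1, so the expansion of `f` bounds its supremum. This
also makes point evaluations continuous on `M¹`. -/
theorem MemM1.norm_le {f : EuclideanSpace ℝ ι → ℂ} (hf : MemM1 f) (t : EuclideanSpace ℝ ι) :
    ‖f t‖ ≤ (gaussNormSq ι)⁻¹ * ∫ r, ‖stft f r‖ := by
  have h := hf.expansion t
  have h1 : ‖f t‖ * gaussNormSq ι = ‖∫ r, stft f r * tfShift r gaussWindow t‖ := by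
    rw [h, norm_mul, Complex.norm_real, Real.norm_eq_abs, abs_of_pos gaussNormSq_pos]
  have h2 : ‖∫ r, stft f r * tfShift r gaussWindow t‖ ≤ ∫ r, ‖stft f r‖ := by
    refine norm_integral_le_of_norm_le hf.integrable_stft.norm (Eventually.of_forall fun r => ?_)
    rw [norm_mul, norm_tfShift]
    exact mul_le_of_le_one_right (norm_nonneg _) (norm_gaussWindow_le_one _)
  rw [← h1] at h2
  rw [inv_mul_eq_div, le_div_iff₀ gaussNormSq_pos]
  exact h2

/-- A bounded continuous function with integrable short-time Fourier transform is in `M¹`. -/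
theorem memM1_of_bounded {f : EuclideanSpace ℝ ι → ℂ} (hf : Continuous f) {C : ℝ}
    (hC : ∀ t, ‖f t‖ ≤ C) (hs : Integrable (stft f)) : MemM1 f := by
  refine ⟨hf, ?_, hs⟩
  -- All shifts of the Gaussian have the same `L¹` norm, so the expansion with integrable
  -- coefficients converges in `L¹`; bounded and integrable then gives square integrable.
  have hI : Integrable f := by
    have h1 : Integrable (fun q : EuclideanSpace ℝ ι × (EuclideanSpace ℝ ι × EuclideanSpace ℝ ι) =>
        stft f q.2 * tfShift q.2 gaussWindow q.1) (volume.prod volume) := by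
      rw [integrable_prod_iff']
      · constructor
        · refine Eventually.of_forall fun r => ?_
          suffices h : Integrable (fun t => tfShift r gaussWindow t) from h.const_mul (stft f r)
          have := integrable_gaussWindow.comp_sub_right r.1
          refine this.mono ?_ (Eventually.of_forall fun t => (norm_tfShift _ _ _).le)
          exact (continuous_gaussWindow.tfShift r).aestronglyMeasurable
        · simp only [norm_mul, norm_tfShift, integral_const_mul]
          have h2 : ∀ r : EuclideanSpace ℝ ι × EuclideanSpace ℝ ι,
              ∫ t, ‖gaussWindow (t - r.1)‖ = ∫ t : EuclideanSpace ℝ ι, ‖gaussWindow t‖ :=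
            fun r => integral_sub_right_eq_self (fun t => ‖gaussWindow t‖) r.1
          simp only [h2]
          exact hs.norm.mul_const _
      · refine (hs.aestronglyMeasurable.comp_snd).mul ?_
        exact ((continuous_tfShift continuous_gaussWindow).comp
            (by fun_prop : Continuous fun q : EuclideanSpace ℝ ι ×
              (EuclideanSpace ℝ ι × EuclideanSpace ℝ ι) => (q.2, q.1))).aestronglyMeasurable
    have h2 := h1.integral_prod_left
    have h3 : ∀ t, ∫ r, stft f r * tfShift r gaussWindow t =
        f t * (gaussNormSq ι : ℂ) := fun t => by
      rw [stft_inversion hf (integrable_bounded_mul_gaussWindow hf hC) hs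
        continuous_gaussWindow norm_gaussWindow_le_one, integral_gaussWindow_mul_self]
    simp only [h3] at h2
    have h4 : (gaussNormSq ι : ℂ) ≠ 0 := by exact_mod_cast gaussNormSq_pos.ne'
    refine (h2.mul_const (gaussNormSq ι : ℂ)⁻¹).congr (Eventually.of_forall fun t => ?_)
    beta_reduce
    rw [mul_assoc, mul_inv_cancel₀ h4, mul_one]
  rw [memLp_two_iff_integrable_sq_norm hf.aestronglyMeasurable]
  simp only [sq]
  exact hI.norm.bdd_mul hf.norm.aestronglyMeasurable
    (Eventually.of_forall fun t => by rw [norm_norm]; exact hC t)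

theorem measurable_stft_tfShift {X : Type*} [MeasurableSpace X]
    {r : X → EuclideanSpace ℝ ι × EuclideanSpace ℝ ι} (hr : Measurable r)
    {G : EuclideanSpace ℝ ι → ℂ} (hG : Continuous G) {C : ℝ} (hC : ∀ t, ‖G t‖ ≤ C) :
    Measurable fun q : X × (EuclideanSpace ℝ ι × EuclideanSpace ℝ ι) =>
      stft (tfShift (r q.1) G) q.2 := by
  have hcs := continuous_stft hG hC
  simp only [stft_tfShift]
  have hc : Continuous fun q : (EuclideanSpace ℝ ι × EuclideanSpace ℝ ι) ×
      (EuclideanSpace ℝ ι × EuclideanSpace ℝ ι) =>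
      unitExp (-2 * Real.pi * inner ℝ q.1.1 (q.2.2 - q.1.2)) * stft G (q.2 - q.1) := by
    fun_prop
  have h1 : Measurable fun q : X × (EuclideanSpace ℝ ι × EuclideanSpace ℝ ι) => (r q.1, q.2) :=
    (hr.comp measurable_fst).prodMk measurable_snd
  have h2 := hc.measurable.comp h1
  exact h2

theorem integral_norm_stft_tfShift (r : EuclideanSpace ℝ ι × EuclideanSpace ℝ ι)
    (G : EuclideanSpace ℝ ι → ℂ) : ∫ p, ‖stft (tfShift r G) p‖ = ∫ p, ‖stft G p‖ := by
  simp only [norm_stft_tfShift]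
  exact integral_sub_right_eq_self (fun p => ‖stft G p‖) r

theorem integrable_stft_tfShift {G : EuclideanSpace ℝ ι → ℂ} (hG : Continuous G) {C : ℝ}
    (hC : ∀ t, ‖G t‖ ≤ C) (hGs : Integrable (stft G))
    (r : EuclideanSpace ℝ ι × EuclideanSpace ℝ ι) : Integrable (stft (tfShift r G)) := by
  have hcs : Continuous (stft (tfShift r G)) :=
    continuous_stft (hG.tfShift r) (fun t => (norm_tfShift r G t).trans_le (hC _))
  exact (hGs.comp_sub_right r).mono hcs.aestronglyMeasurable
    (Eventually.of_forall fun p => (norm_stft_tfShift _ _ _).le)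

theorem integrable_mul_stft_tfShift {X : Type*} [MeasurableSpace X] {μ : Measure X} [SFinite μ]
    {a : X → ℂ} (ha : Integrable a μ) {r : X → EuclideanSpace ℝ ι × EuclideanSpace ℝ ι}
    (hr : Measurable r) {G : EuclideanSpace ℝ ι → ℂ} (hG : Continuous G) {C : ℝ}
    (hC : ∀ t, ‖G t‖ ≤ C) (hGs : Integrable (stft G)) :
    Integrable (fun q : (EuclideanSpace ℝ ι × EuclideanSpace ℝ ι) × X =>
      a q.2 * stft (tfShift (r q.2) G) q.1) (volume.prod μ) := by
  rw [integrable_prod_iff']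
  · constructor
    · exact Eventually.of_forall fun s => (integrable_stft_tfShift hG hC hGs (r s)).const_mul (a s)
    · simp only [norm_mul, integral_const_mul, integral_norm_stft_tfShift]
      exact ha.norm.mul_const _
  · have h1 := (measurable_stft_tfShift hr hG hC).comp (measurable_swap
      (α := EuclideanSpace ℝ ι × EuclideanSpace ℝ ι) (β := X))
    exact ha.aestronglyMeasurable.comp_snd.mul h1.aestronglyMeasurable

/-- Shifts preserve both the supremum norm and the norm of `M¹`, so integrable coefficients suffice
and Fubini lets `stft` pass under the integral. The parameter space `X` is arbitrary: it is phase
space in the density argument, and a product of two phase spaces in the expansion of `B_A(f, g)`. -/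
theorem memM1_synthesis {X : Type*} [MeasurableSpace X] {μ : Measure X} [SFinite μ] {a : X → ℂ}
    (ha : Integrable a μ) {r : X → EuclideanSpace ℝ ι × EuclideanSpace ℝ ι} (hr : Measurable r)
    {G H : EuclideanSpace ℝ ι → ℂ} (hG : Continuous G) {C : ℝ} (hC : ∀ t, ‖G t‖ ≤ C)
    (hGs : Integrable (stft G)) (hH : ∀ t, H t = ∫ s, a s * tfShift (r s) G t ∂μ) :
    MemM1 H ∧ (∀ p, stft H p = ∫ s, a s * stft (tfShift (r s) G) p ∂μ) ∧
      ∫ p, ‖stft H p‖ ≤ (∫ s, ‖a s‖ ∂μ) * ∫ p, ‖stft G p‖ := by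
  have hC0 : 0 ≤ C := (norm_nonneg _).trans (hC 0)
  have hmeas : Measurable fun q : X × EuclideanSpace ℝ ι => tfShift (r q.1) G q.2 :=
    measurable_tfShift hr hG
  have hHc : Continuous H := by
    rw [funext hH]
    refine continuous_of_dominated (F := fun t s => a s * tfShift (r s) G t)
      (bound := fun s => ‖a s‖ * C) (fun t => ?_) (fun t => Eventually.of_forall fun s => ?_)
      (ha.norm.mul_const C) (Eventually.of_forall fun s => ?_)
    · have h1 : Measurable (fun s => tfShift (r s) G t) := hmeas.of_uncurry_right
      exact ha.aestronglyMeasurable.mul h1.aestronglyMeasurable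
    · rw [norm_mul, norm_tfShift]
      exact mul_le_mul_of_nonneg_left (hC _) (norm_nonneg _)
    · exact continuous_const.mul (hG.tfShift (r s))
  have hHb : ∀ t, ‖H t‖ ≤ (∫ s, ‖a s‖ ∂μ) * C := fun t => by
    rw [hH, ← integral_mul_const]
    refine norm_integral_le_of_norm_le (ha.norm.mul_const C) (Eventually.of_forall fun s => ?_)
    rw [norm_mul, norm_tfShift]
    exact mul_le_mul_of_nonneg_left (hC _) (norm_nonneg _)
  have hst : ∀ p, stft H p = ∫ s, a s * stft (tfShift (r s) G) p ∂μ := fun p => by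
    have hsw : Integrable (Function.uncurry fun (y : EuclideanSpace ℝ ι) (s : X) =>
        (a s * tfShift (r s) G y) * gaussWindow (y - p.1) *
          unitExp (-2 * Real.pi * inner ℝ y p.2)) (volume.prod μ) := by
      have hb : Integrable (fun q : EuclideanSpace ℝ ι × X => gaussWindow (q.1 - p.1) * a q.2)
          (volume.prod μ) := (integrable_gaussWindow.comp_sub_right p.1).mul_prod ha
      have hb2 : Integrable (fun q : EuclideanSpace ℝ ι × X =>
          (tfShift (r q.2) G q.1 * unitExp (-2 * Real.pi * inner ℝ q.1 p.2)) *
            (gaussWindow (q.1 - p.1) * a q.2)) (volume.prod μ) := by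
        refine hb.bdd_mul (c := C) ?_ (Eventually.of_forall fun q => ?_)
        · refine Measurable.aestronglyMeasurable ?_
          have h1 := hmeas.comp (measurable_swap (α := EuclideanSpace ℝ ι) (β := X))
          have h2 : Continuous fun y : EuclideanSpace ℝ ι =>
            unitExp (-2 * Real.pi * inner ℝ y p.2) := by fun_prop
          have h3 := h2.measurable.comp
            (measurable_fst : Measurable (Prod.fst : EuclideanSpace ℝ ι × X → _))
          exact h1.mul h3
        · rw [norm_mul, norm_unitExp, mul_one, norm_tfShift]
          exact hC _
      refine hb2.congr (Eventually.of_forall fun q => ?_)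
      simp only [Function.uncurry]
      ring
    calc stft H p = ∫ y, ∫ s, (a s * tfShift (r s) G y) * gaussWindow (y - p.1) *
          unitExp (-2 * Real.pi * inner ℝ y p.2) ∂μ := by
          rw [stft_eq]
          simp only [integral_mul_const, hH]
      _ = _ := by
          rw [integral_integral_swap hsw]
          refine integral_congr_ae (Eventually.of_forall fun s => ?_)
          simp only [stft_eq, mul_assoc, integral_const_mul]
  have hI := integrable_mul_stft_tfShift ha hr hG hC hGs
  have hHs : Integrable (stft H) := by
    rw [funext hst]
    exact hI.integral_prod_left
  refine ⟨memM1_of_bounded hHc hHb hHs, hst, ?_⟩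
  calc ∫ p, ‖stft H p‖ ≤ ∫ p, ∫ s, ‖a s * stft (tfShift (r s) G) p‖ ∂μ := by
        refine integral_mono hHs.norm hI.norm.integral_prod_left fun p => ?_
        simp only [hst p]
        exact norm_integral_le_integral_norm _
    _ = ∫ s, (∫ p, ‖a s * stft (tfShift (r s) G) p‖) ∂μ := integral_integral_swap hI.norm
    _ = _ := by
        simp only [norm_mul, integral_const_mul, integral_norm_stft_tfShift]
        rw [integral_mul_const]

end Modulation

/-! ### Gaussian decay of short-time Fourier transforms of Gaussians -/

section GaussianDecay

theorem exists_pos_le_norm_apply {E F : Type*} [NormedAddCommGroup E] [NormedSpace ℝ E]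
    [FiniteDimensional ℝ E] [NormedAddCommGroup F] [NormedSpace ℝ F] (L : E →ₗ[ℝ] F)
    (hL : Function.Injective L) : ∃ k > 0, ∀ x, k * ‖x‖ ^ 2 ≤ ‖L x‖ ^ 2 := by
  obtain ⟨K, hK, h⟩ := L.exists_antilipschitzWith (LinearMap.ker_eq_bot.2 hL)
  have hK' : (0 : ℝ) < K := by exact_mod_cast hK
  refine ⟨((K : ℝ) ^ 2)⁻¹, by positivity, fun x => ?_⟩
  have h1 := h.le_mul_dist x 0
  rw [map_zero, dist_zero_right, dist_zero_right] at h1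
  rw [inv_mul_le_iff₀ (by positivity), ← mul_pow]
  gcongr

/-- For a linear operator `L` there is `S` with `S*S = L*L + 1`. -/
theorem exists_linearEquiv_inner_eq_add {E F : Type*} [NormedAddCommGroup E]
    [InnerProductSpace ℝ E] [FiniteDimensional ℝ E] [NormedAddCommGroup F]
    [InnerProductSpace ℝ F] (L : E →ₗ[ℝ] F) :
    ∃ S : E ≃ₗ[ℝ] E, ∀ u v, inner ℝ (S u) (S v) = inner ℝ (L u) (L v) + inner ℝ u v := by
  -- The graph map `u ↦ (L u, u)` has the required Gram form. Its range has the dimension of `E`, so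
  -- an isometry carries it back to `E`.
  let T : E →ₗ[ℝ] WithLp 2 (F × E) :=
    (WithLp.linearEquiv 2 ℝ (F × E)).symm.toLinearMap ∘ₗ L.prod LinearMap.id
  have hT : ∀ u v, inner ℝ (T u) (T v) = inner ℝ (L u) (L v) + inner ℝ u v := fun u v => by
    rw [WithLp.prod_inner_apply]
    rfl
  have hinj : Function.Injective T := fun u v h => congrArg (fun w => w.snd) h
  let e := LinearEquiv.ofInjective T hinj
  have hfin : Module.finrank ℝ (LinearMap.range T) = Module.finrank ℝ E := e.finrank_eq.symm
  let i : LinearMap.range T ≃ₗᵢ[ℝ] E :=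
    (stdOrthonormalBasis ℝ (LinearMap.range T)).equiv (stdOrthonormalBasis ℝ E) (finCongr hfin)
  refine ⟨e.trans i.toLinearEquiv, fun u v => ?_⟩
  rw [← hT]
  change inner ℝ (i (e u)) (i (e v)) = _
  rw [i.inner_map_map]
  rfl

variable {ι : Type*} [Fintype ι]

theorem integral_comp_linearEquiv (S : EuclideanSpace ℝ ι ≃ₗ[ℝ] EuclideanSpace ℝ ι)
    (g : EuclideanSpace ℝ ι → ℂ) :
    ∫ z, g (S z) = (|(LinearMap.det (S : EuclideanSpace ℝ ι →ₗ[ℝ] EuclideanSpace ℝ ι))⁻¹| : ℝ) •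
      ∫ u, g u := by
  have h := Measure.map_linearMap_addHaar_eq_smul_addHaar
    (volume : Measure (EuclideanSpace ℝ ι)) (LinearEquiv.isUnit_det' S).ne_zero
  have h2 := S.toContinuousLinearEquiv.toHomeomorph.measurableEmbedding.integral_map
    (μ := volume) g
  have h3 : Measure.map (S.toContinuousLinearEquiv.toHomeomorph) volume =
      Measure.map (S : EuclideanSpace ℝ ι →ₗ[ℝ] EuclideanSpace ℝ ι) volume := rfl
  rw [h3, h, integral_smul_measure, ENNReal.toReal_ofReal (abs_nonneg _)] at h2
  exact h2.symm

/-- The short-time Fourier transform of a nondegenerate real Gaussian has Gaussian decay. -/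
theorem exists_norm_stft_gaussWindow_comp_le
    (L : EuclideanSpace ℝ ι →ₗ[ℝ] EuclideanSpace ℝ ι) (hL : Function.Injective L) :
    ∃ C ε : ℝ, 0 < ε ∧ ∀ p, ‖stft (fun z => gaussWindow (L z)) p‖ ≤
      C * Real.exp (-(ε * (‖p.1‖ ^ 2 + ‖p.2‖ ^ 2))) := by
  obtain ⟨S, hS⟩ := exists_linearEquiv_inner_eq_add L
  let R : EuclideanSpace ℝ ι →ₗ[ℝ] EuclideanSpace ℝ ι :=
    LinearMap.adjoint (S.symm : EuclideanSpace ℝ ι →ₗ[ℝ] EuclideanSpace ℝ ι)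
  have hR : ∀ u w, inner ℝ (S.symm u) w = inner ℝ u (R w) := fun u w =>
    (LinearMap.adjoint_inner_right _ _ _).symm
  have hRi : Function.Injective R := by
    refine (injective_iff_map_eq_zero R).2 fun w hw => ?_
    have h := hR (S w) w
    rw [hw, inner_zero_right, S.symm_apply_apply] at h
    exact inner_self_eq_zero.1 h
  -- With `R` the adjoint of `S⁻¹`, this is `(S*S)⁻¹ = (L*L + 1)⁻¹`, so `c x` minimizes `‖L z‖² + ‖z
  -- - x‖²` over `z`.
  let c : EuclideanSpace ℝ ι →ₗ[ℝ] EuclideanSpace ℝ ι :=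
    (S.symm : EuclideanSpace ℝ ι →ₗ[ℝ] EuclideanSpace ℝ ι) ∘ₗ R
  have hSc : ∀ x, S (c x) = R x := fun x => S.apply_symm_apply _
  have hzx : ∀ z x, inner ℝ z x = inner ℝ (S z) (S (c x)) := fun z x => by
    rw [hSc, ← hR, S.symm_apply_apply]
  obtain ⟨k₁, hk₁, h₁⟩ := exists_pos_le_norm_apply (L ∘ₗ c)
    (hL.comp (S.symm.injective.comp hRi))
  obtain ⟨k₂, hk₂, h₂⟩ := exists_pos_le_norm_apply R hRi
  -- Completing the square around the minimizer.
  have hquad : ∀ z x, ‖L z‖ ^ 2 + ‖z - x‖ ^ 2 =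
      ‖S (z - c x)‖ ^ 2 + (‖L (c x)‖ ^ 2 + ‖c x - x‖ ^ 2) := fun z x => by
    have e1 := hS z z
    have e2 := hS z (c x)
    have e3 := hS (c x) (c x)
    have e4 := hzx z x
    have e5 := hzx (c x) x
    simp only [← real_inner_self_eq_norm_sq, map_sub, inner_sub_left, inner_sub_right]
    rw [real_inner_comm z x, real_inner_comm (S z) (S (c x)), real_inner_comm (c x) x]
    linarith
  let D : ℝ := |(LinearMap.det (S : EuclideanSpace ℝ ι →ₗ[ℝ] EuclideanSpace ℝ ι))⁻¹|
  -- The minimal value gives the decay in `p.1`. The remaining integral is the Fourier transform of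
  -- `φ ∘ S`, namely `D * φ (R p.2)`, which gives the decay in `p.2`.
  have hst : ∀ p, ‖stft (fun z => gaussWindow (L z)) p‖ =
      Real.exp (-(Real.pi * (‖L (c p.1)‖ ^ 2 + ‖c p.1 - p.1‖ ^ 2))) *
        (D * Real.exp (-(Real.pi * ‖R p.2‖ ^ 2))) := fun p => by
    have hint : stft (fun z => gaussWindow (L z)) p =
        ((Real.exp (-(Real.pi * (‖L (c p.1)‖ ^ 2 + ‖c p.1 - p.1‖ ^ 2))) : ℝ) : ℂ) *
          (unitExp (-2 * Real.pi * inner ℝ (c p.1) p.2) *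
            ∫ z, gaussWindow (S z) * unitExp (-2 * Real.pi * inner ℝ (S z) (R p.2))) := by
      rw [stft_eq, ← integral_const_mul, ← integral_const_mul,
        ← integral_add_right_eq_self (μ := volume) _ (c p.1)]
      refine integral_congr_ae (Eventually.of_forall fun z => ?_)
      have hu : unitExp (-2 * Real.pi * inner ℝ (z + c p.1) p.2) =
          unitExp (-2 * Real.pi * inner ℝ (c p.1) p.2) *
            unitExp (-2 * Real.pi * inner ℝ (S z) (R p.2)) := by
        rw [← unitExp_add, ← hR, S.symm_apply_apply, inner_add_left]
        congr 1
        ring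
      have hg : gaussWindow (L (z + c p.1)) * gaussWindow (z + c p.1 - p.1) =
          ((Real.exp (-(Real.pi * (‖L (c p.1)‖ ^ 2 + ‖c p.1 - p.1‖ ^ 2))) : ℝ) : ℂ) *
            gaussWindow (S z) := by
        have hq := hquad (z + c p.1) p.1
        rw [add_sub_cancel_right] at hq
        simp only [gaussWindow]
        rw [← Complex.ofReal_mul, ← Complex.ofReal_mul, ← Real.exp_add, ← Real.exp_add]
        congr 2
        linear_combination (-Real.pi) * hq
      beta_reduce
      rw [hg, hu]
      ring
    rw [hint, integral_comp_linearEquiv S (fun u => gaussWindow u *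
      unitExp (-2 * Real.pi * inner ℝ u (R p.2))), integral_gaussWindow_mul_unitExp, norm_mul,
      norm_mul, norm_unitExp, one_mul, norm_smul, norm_gaussWindow, Complex.norm_real,
      Real.norm_of_nonneg (Real.exp_pos _).le, Real.norm_of_nonneg (abs_nonneg _)]
  refine ⟨D, Real.pi * min k₁ k₂, by positivity, fun p => ?_⟩
  rw [hst, mul_left_comm, ← Real.exp_add]
  refine mul_le_mul_of_nonneg_left (Real.exp_le_exp.2 ?_) (abs_nonneg _)
  have e1 : min k₁ k₂ * ‖p.1‖ ^ 2 ≤ ‖L (c p.1)‖ ^ 2 :=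
    (mul_le_mul_of_nonneg_right (min_le_left _ _) (sq_nonneg _)).trans (h₁ p.1)
  have e2 : min k₁ k₂ * ‖p.2‖ ^ 2 ≤ ‖R p.2‖ ^ 2 :=
    (mul_le_mul_of_nonneg_right (min_le_right _ _) (sq_nonneg _)).trans (h₂ p.2)
  have e3 := sq_nonneg ‖c p.1 - p.1‖
  nlinarith [Real.pi_pos]

theorem integrable_exp_neg_mul_add_sq_norm {ε : ℝ} (hε : 0 < ε) :
    Integrable fun p : EuclideanSpace ℝ ι × EuclideanSpace ℝ ι =>
      Real.exp (-(ε * (‖p.1‖ ^ 2 + ‖p.2‖ ^ 2))) := by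
  have h := (integrable_exp_neg_mul_sq_norm (ι := ι) hε).mul_prod
    (integrable_exp_neg_mul_sq_norm (ι := ι) hε)
  refine h.congr (Eventually.of_forall fun p => ?_)
  simp only [← Real.exp_add]
  ring_nf

end GaussianDecay

/-! ### The splitting of `ℝ^{2d}` into position and frequency -/

namespace Phase

variable {d : ℕ}

/-- The point `(x, ω)` of `ℝ^{2d}`. -/
def pair (x w : Pos d) : Phase d := WithLp.toLp 2 (Sum.elim x.ofLp w.ofLp)

@[simp] theorem fst_pair (x w : Pos d) : (pair x w).fst = x := rfl

@[simp] theorem snd_pair (x w : Pos d) : (pair x w).snd = w := rfl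

theorem pair_fst_snd (z : Phase d) : pair z.fst z.snd = z := by
  refine PiLp.ext fun i => ?_
  cases i <;> rfl

theorem ext_fst_snd {z z' : Phase d} (h1 : z.fst = z'.fst) (h2 : z.snd = z'.snd) : z = z' := by
  rw [← pair_fst_snd z, h1, h2, pair_fst_snd]

theorem inner_eq (z z' : Phase d) :
    inner ℝ z z' = inner ℝ z.fst z'.fst + inner ℝ z.snd z'.snd := by
  simp only [PiLp.inner_apply, Fintype.sum_sum_type]
  rfl

theorem norm_sq_eq (z : Phase d) : ‖z‖ ^ 2 = ‖z.fst‖ ^ 2 + ‖z.snd‖ ^ 2 := by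
  simp only [← real_inner_self_eq_norm_sq, inner_eq]

@[simp] theorem fst_sub (z z' : Phase d) : (z - z').fst = z.fst - z'.fst := rfl

@[simp] theorem snd_sub (z z' : Phase d) : (z - z').snd = z.snd - z'.snd := rfl

@[fun_prop] theorem continuous_fst : Continuous (fst : Phase d → Pos d) := by
  unfold fst
  fun_prop

@[fun_prop] theorem continuous_snd : Continuous (snd : Phase d → Pos d) := by
  unfold snd
  fun_prop

theorem continuous_pair : Continuous fun p : Pos d × Pos d => pair p.1 p.2 := by
  have h : Continuous fun p : Pos d × Pos d => Sum.elim p.1.ofLp p.2.ofLp := by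
    refine continuous_pi fun i => ?_
    cases i <;> simp only [Sum.elim_inl, Sum.elim_inr] <;> fun_prop
  exact (PiLp.continuous_toLp 2 _).comp h

@[fun_prop] theorem _root_.Continuous.phasePair {X : Type*} [TopologicalSpace X] {f g : X → Pos d}
    (hf : Continuous f) (hg : Continuous g) : Continuous fun s => pair (f s) (g s) :=
  continuous_pair.comp (hf.prodMk hg)

theorem gaussWindow_eq (z : Phase d) : gaussWindow z = gaussWindow z.fst * gaussWindow z.snd := by
  simp only [gaussWindow, norm_sq_eq]
  rw [← Complex.ofReal_mul, ← Real.exp_add]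
  ring_nf

/-- The splitting of `ℝ^{2d}`, as a measurable equivalence. -/
def pairEquiv (d : ℕ) : Pos d × Pos d ≃ᵐ Phase d where
  toFun p := pair p.1 p.2
  invFun z := (z.fst, z.snd)
  left_inv _ := rfl
  right_inv z := pair_fst_snd z
  measurable_toFun := continuous_pair.measurable
  measurable_invFun := (continuous_fst.measurable).prodMk continuous_snd.measurable

theorem measurePreserving_pairEquiv : MeasurePreserving (pairEquiv d) := by
  have h1 := (PiLp.volume_preserving_ofLp (Fin d)).prod (PiLp.volume_preserving_ofLp (Fin d))
  have h2 := volume_measurePreserving_sumPiEquivProdPi_symm (fun _ : Fin d ⊕ Fin d => ℝ)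
  have h3 := PiLp.volume_preserving_toLp (Fin d ⊕ Fin d)
  have h4 := (h3.comp h2).comp h1
  refine ⟨(pairEquiv d).measurable, ?_⟩
  have h5 : ⇑(pairEquiv d) = (WithLp.toLp 2 ∘
      (MeasurableEquiv.sumPiEquivProdPi fun _ : Fin d ⊕ Fin d => ℝ).symm) ∘
      Prod.map WithLp.ofLp WithLp.ofLp := by
    funext p
    refine PiLp.ext fun i => ?_
    cases i <;> rfl
  rw [h5]
  exact h4.map_eq

theorem integral_eq (F : Phase d → ℂ) : ∫ z, F z = ∫ p : Pos d × Pos d, F (pair p.1 p.2) :=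
  (measurePreserving_pairEquiv.integral_comp' F).symm

end Phase

/-! ### The generalized Gaussian `B_A(φ, φ)` -/

section Matrix

open Phase

variable {d : ℕ}

/-- A real `2d × 2d` matrix acting on `ℝ^{2d}`. -/
def matMap (A : Matrix (Fin d ⊕ Fin d) (Fin d ⊕ Fin d) ℝ) : Phase d →ₗ[ℝ] Phase d :=
  Matrix.toEuclideanLin A

theorem fst_matMap (A : Matrix (Fin d ⊕ Fin d) (Fin d ⊕ Fin d) ℝ) (x y : Pos d) :
    (matMap A (pair x y)).fst =
      matAct A.toBlocks₁₁ x + matAct A.toBlocks₁₂ y := by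
  refine PiLp.ext fun i => ?_
  have h := congrFun (Matrix.fromBlocks_mulVec A.toBlocks₁₁ A.toBlocks₁₂ A.toBlocks₂₁ A.toBlocks₂₂
    (Sum.elim x.ofLp y.ofLp)) (Sum.inl i)
  rw [Matrix.fromBlocks_toBlocks] at h
  exact h

theorem snd_matMap (A : Matrix (Fin d ⊕ Fin d) (Fin d ⊕ Fin d) ℝ) (x y : Pos d) :
    (matMap A (pair x y)).snd =
      matAct A.toBlocks₂₁ x + matAct A.toBlocks₂₂ y := by
  refine PiLp.ext fun i => ?_
  have h := congrFun (Matrix.fromBlocks_mulVec A.toBlocks₁₁ A.toBlocks₁₂ A.toBlocks₂₁ A.toBlocks₂₂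
    (Sum.elim x.ofLp y.ofLp)) (Sum.inr i)
  rw [Matrix.fromBlocks_toBlocks] at h
  exact h

theorem matrixWigner_eq (A : Matrix (Fin d ⊕ Fin d) (Fin d ⊕ Fin d) ℝ) (f g : Pos d → ℂ)
    (z : Phase d) :
    matrixWigner A f g z = ∫ y : Pos d, unitExp (-2 * Real.pi * inner ℝ y z.snd) *
      f (matMap A (pair z.fst y)).fst *
      starRingEnd ℂ (g (matMap A (pair z.fst y)).snd) := by
  simp only [fst_matMap, snd_matMap]
  rfl

theorem matMap_injective {A : Matrix (Fin d ⊕ Fin d) (Fin d ⊕ Fin d) ℝ}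
    (hA : A.det ≠ 0) : Function.Injective (matMap A) := by
  intro u v h
  have h1 : A.mulVec u.ofLp = A.mulVec v.ofLp := congrArg WithLp.ofLp h
  exact WithLp.ofLp_injective 2 (Matrix.mulVec_injective_iff_isUnit.2
    ((Matrix.isUnit_iff_isUnit_det A).2 hA.isUnit) h1)

/-- The generalized Gaussian `B_A(φ, φ)`. -/
def wignerGauss (A : Matrix (Fin d ⊕ Fin d) (Fin d ⊕ Fin d) ℝ) : Phase d → ℂ :=
  matrixWigner A gaussWindow gaussWindow

theorem wignerGauss_eq (A : Matrix (Fin d ⊕ Fin d) (Fin d ⊕ Fin d) ℝ) (z : Phase d) :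
    wignerGauss A z = ∫ y : Pos d, unitExp (-2 * Real.pi * inner ℝ y z.snd) *
      gaussWindow (matMap A (pair z.fst y)) := by
  rw [wignerGauss, matrixWigner_eq]
  simp only [conj_gaussWindow, mul_assoc, gaussWindow_eq]

theorem continuous_matMap (A : Matrix (Fin d ⊕ Fin d) (Fin d ⊕ Fin d) ℝ) :
    Continuous (matMap A) := LinearMap.continuous_of_finiteDimensional _

/-- Invertibility of `A` bounds `‖A z‖` below by a multiple of `‖z‖`. Discarding the first component
leaves a majorant in `y` uniform in `x`, which dominates the integrals defining `B_A`. -/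
theorem exists_norm_gaussWindow_matMap_le
    {A : Matrix (Fin d ⊕ Fin d) (Fin d ⊕ Fin d) ℝ} (hA : A.det ≠ 0) :
    ∃ ε > 0, ∀ z : Phase d, ‖gaussWindow (matMap A z)‖ ≤ Real.exp (-(ε * ‖z.snd‖ ^ 2)) := by
  obtain ⟨k, hk, h⟩ := exists_pos_le_norm_apply _ (matMap_injective hA)
  refine ⟨Real.pi * k, by positivity, fun z => ?_⟩
  rw [norm_gaussWindow, Real.exp_le_exp, neg_le_neg_iff, mul_assoc]
  refine mul_le_mul_of_nonneg_left (le_trans ?_ (h z)) Real.pi_pos.le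
  refine mul_le_mul_of_nonneg_left ?_ hk.le
  rw [norm_sq_eq]
  linarith [sq_nonneg ‖z.fst‖]

theorem wignerGauss_bounded {A : Matrix (Fin d ⊕ Fin d) (Fin d ⊕ Fin d) ℝ} (hA : A.det ≠ 0) :
    Continuous (wignerGauss A) ∧ ∃ C, ∀ z, ‖wignerGauss A z‖ ≤ C := by
  obtain ⟨ε, hε, h⟩ := exists_norm_gaussWindow_matMap_le hA
  have hle : ∀ (z : Phase d) (y : Pos d), ‖unitExp (-2 * Real.pi * inner ℝ y z.snd) *
      gaussWindow (matMap A (pair z.fst y))‖ ≤ Real.exp (-(ε * ‖y‖ ^ 2)) :=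
    fun z y => by
      rw [norm_mul, norm_unitExp, one_mul]
      exact h _
  have hc := continuous_matMap A
  constructor
  · rw [funext (wignerGauss_eq A)]
    refine continuous_of_dominated (bound := fun y => Real.exp (-(ε * ‖y‖ ^ 2)))
      (fun z => Continuous.aestronglyMeasurable (by fun_prop))
      (fun z => Eventually.of_forall (hle z)) (integrable_exp_neg_mul_sq_norm hε)
      (Eventually.of_forall fun y => by fun_prop)
  · refine ⟨∫ y : Pos d, Real.exp (-(ε * ‖y‖ ^ 2)), fun z => ?_⟩
    rw [wignerGauss_eq]
    exact norm_integral_le_of_norm_le (integrable_exp_neg_mul_sq_norm hε)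
      (Eventually.of_forall (hle z))

/-- The partial Fourier transform acts on short-time Fourier transforms by a partial rotation. -/
theorem stft_wignerGauss {A : Matrix (Fin d ⊕ Fin d) (Fin d ⊕ Fin d) ℝ} (hA : A.det ≠ 0)
    (z ζ : Phase d) : stft (wignerGauss A) (z, ζ) = unitExp (-2 * Real.pi * inner ℝ z.snd ζ.snd) *
      stft (fun z => gaussWindow (matMap A z))
        (pair z.fst (-ζ.snd), pair ζ.fst z.snd) := by
  obtain ⟨ε, hε, hQ⟩ := exists_norm_gaussWindow_matMap_le hA
  obtain ⟨hGc, C, hGC⟩ := wignerGauss_bounded hA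
  have hc := continuous_matMap A
  have hI1 : Integrable fun p : Pos d × Pos d =>
      wignerGauss A (pair p.1 p.2) * gaussWindow (pair p.1 p.2 - z) *
        unitExp (-2 * Real.pi * inner ℝ (pair p.1 p.2) ζ) := by
    have h := integrable_bounded_mul_gaussWindow hGc hGC z
    have h2 : Integrable fun u => wignerGauss A u * gaussWindow (u - z) *
        unitExp (-2 * Real.pi * inner ℝ u ζ) :=
      h.mul_bdd (c := 1) (Continuous.aestronglyMeasurable (by fun_prop))
        (Eventually.of_forall fun u => (norm_unitExp _).le)
    exact (measurePreserving_pairEquiv.integrable_comp_emb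
      (pairEquiv d).measurableEmbedding).2 h2
  have hI2 : Integrable fun p : Pos d × Pos d =>
      gaussWindow (matMap A (pair p.1 p.2)) *
        gaussWindow (pair p.1 p.2 - pair z.fst (-ζ.snd)) *
        unitExp (-2 * Real.pi * inner ℝ (pair p.1 p.2) (pair ζ.fst z.snd)) := by
    have h := integrable_bounded_mul_gaussWindow
      (G := fun u => gaussWindow (matMap A u)) (by fun_prop)
      (fun u => norm_gaussWindow_le_one _) (pair z.fst (-ζ.snd))
    have h2 : Integrable fun u => gaussWindow (matMap A u) *
        gaussWindow (u - pair z.fst (-ζ.snd)) *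
        unitExp (-2 * Real.pi * inner ℝ u (pair ζ.fst z.snd)) :=
      h.mul_bdd (c := 1) (Continuous.aestronglyMeasurable (by fun_prop))
        (Eventually.of_forall fun u => (norm_unitExp _).le)
    exact (measurePreserving_pairEquiv.integrable_comp_emb
      (pairEquiv d).measurableEmbedding).2 h2
  rw [stft_eq, stft_eq, Phase.integral_eq, Phase.integral_eq]
  rw [Measure.volume_eq_prod] at hI1 hI2 ⊢
  rw [integral_prod _ hI1, integral_prod _ hI2, ← integral_const_mul]
  refine integral_congr_ae (Eventually.of_forall fun x => ?_)
  -- Only the second variable is transformed; `x` stays fixed. The transform of the window centred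
  -- at `z.snd` is again a window, now centred at `-ζ.snd` and modulated by `z.snd`: this is the
  -- quarter turn.
  have hw : ∀ y : Pos d, ∫ w : Pos d, unitExp (-2 * Real.pi * inner ℝ y w) *
      gaussWindow (w - z.snd) * unitExp (-2 * Real.pi * inner ℝ w ζ.snd) =
      unitExp (-2 * Real.pi * inner ℝ z.snd (y + ζ.snd)) * gaussWindow (y + ζ.snd) := fun y => by
    rw [← integral_gaussWindow_mul_unitExp, ← integral_const_mul,
      ← integral_add_right_eq_self (μ := volume) _ z.snd]
    refine integral_congr_ae (Eventually.of_forall fun w => ?_)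
    beta_reduce
    rw [add_sub_cancel_right, mul_right_comm, ← unitExp_add, mul_left_comm, ← unitExp_add,
      mul_comm]
    congr 2
    rw [real_inner_comm]
    simp only [inner_add_left, inner_add_right]
    ring
  -- Absolute convergence: the window decays in `w`, and `φ ∘ A` decays in `y`.
  have hsw : Integrable (Function.uncurry fun (w y : Pos d) =>
      unitExp (-2 * Real.pi * inner ℝ y w) * gaussWindow (matMap A (pair x y)) *
        (gaussWindow (x - z.fst) * gaussWindow (w - z.snd)) *
        unitExp (-2 * Real.pi * (inner ℝ x ζ.fst + inner ℝ w ζ.snd)))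
      (volume.prod volume) := by
    have h1 : Integrable (fun q : Pos d × Pos d =>
        ‖gaussWindow (q.1 - z.snd)‖ * Real.exp (-(ε * ‖q.2‖ ^ 2))) (volume.prod volume) :=
      (integrable_gaussWindow.comp_sub_right z.snd).norm.mul_prod
        (integrable_exp_neg_mul_sq_norm hε)
    refine h1.mono' (Continuous.aestronglyMeasurable ?_) (Eventually.of_forall fun q => ?_)
    · simp only [Function.uncurry_def]
      fun_prop
    · simp only [Function.uncurry, norm_mul, norm_unitExp, one_mul, mul_one]
      have e1 := hQ (pair x q.2)
      have e2 := norm_gaussWindow_le_one (x - z.fst)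
      rw [snd_pair] at e1
      calc _ ≤ Real.exp (-(ε * ‖q.2‖ ^ 2)) * (1 * ‖gaussWindow (q.1 - z.snd)‖) := by gcongr
        _ = _ := by ring
  calc _ = ∫ w, ∫ y, unitExp (-2 * Real.pi * inner ℝ y w) *
        gaussWindow (matMap A (pair x y)) *
        (gaussWindow (x - z.fst) * gaussWindow (w - z.snd)) *
        unitExp (-2 * Real.pi * (inner ℝ x ζ.fst + inner ℝ w ζ.snd)) := by
        refine integral_congr_ae (Eventually.of_forall fun w => ?_)
        simp only [integral_mul_const, wignerGauss_eq, gaussWindow_eq (pair x w - z),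
          Phase.inner_eq, fst_sub, snd_sub, fst_pair, snd_pair]
    _ = ∫ y, ∫ w, unitExp (-2 * Real.pi * inner ℝ y w) *
        gaussWindow (matMap A (pair x y)) *
        (gaussWindow (x - z.fst) * gaussWindow (w - z.snd)) *
        unitExp (-2 * Real.pi * (inner ℝ x ζ.fst + inner ℝ w ζ.snd)) :=
        integral_integral_swap hsw
    _ = ∫ y, (gaussWindow (matMap A (pair x y)) * gaussWindow (x - z.fst) *
          unitExp (-2 * Real.pi * inner ℝ x ζ.fst)) *
          (unitExp (-2 * Real.pi * inner ℝ z.snd (y + ζ.snd)) * gaussWindow (y + ζ.snd)) := by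
        refine integral_congr_ae (Eventually.of_forall fun y => ?_)
        beta_reduce
        rw [← hw, ← integral_const_mul]
        refine integral_congr_ae (Eventually.of_forall fun w => ?_)
        beta_reduce
        rw [mul_add, unitExp_add]
        ring
    _ = _ := by
        beta_reduce
        rw [← integral_const_mul]
        refine integral_congr_ae (Eventually.of_forall fun y => ?_)
        simp only [gaussWindow_eq (pair x y - _), Phase.inner_eq, fst_sub, snd_sub, fst_pair,
          snd_pair, sub_neg_eq_add, inner_add_right, mul_add, unitExp_add, real_inner_comm y z.snd]
        ring

/-- The partial rotation of phase space preserves `‖p.1‖² + ‖p.2‖²`, so the decay known for `φ ∘ A`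
carries over. -/
theorem exists_norm_stft_wignerGauss_le {A : Matrix (Fin d ⊕ Fin d) (Fin d ⊕ Fin d) ℝ}
    (hA : A.det ≠ 0) : ∃ C ε : ℝ, 0 < ε ∧ ∀ p, ‖stft (wignerGauss A) p‖ ≤
      C * Real.exp (-(ε * (‖p.1‖ ^ 2 + ‖p.2‖ ^ 2))) := by
  obtain ⟨C, ε, hε, h⟩ := exists_norm_stft_gaussWindow_comp_le _ (matMap_injective hA)
  refine ⟨C, ε, hε, fun p => ?_⟩
  obtain ⟨z, ζ⟩ := p
  rw [stft_wignerGauss hA, norm_mul, norm_unitExp, one_mul]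
  refine (h _).trans_eq ?_
  simp only [norm_sq_eq, fst_pair, snd_pair, norm_neg]
  ring_nf

theorem integrable_stft_wignerGauss {A : Matrix (Fin d ⊕ Fin d) (Fin d ⊕ Fin d) ℝ}
    (hA : A.det ≠ 0) : Integrable (stft (wignerGauss A)) := by
  obtain ⟨C, ε, hε, h⟩ := exists_norm_stft_wignerGauss_le hA
  obtain ⟨hGc, C', hGC⟩ := wignerGauss_bounded hA
  exact ((integrable_exp_neg_mul_add_sq_norm hε).const_mul C).mono'
    (continuous_stft hGc hGC).aestronglyMeasurable (Eventually.of_forall h)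

/-- At the origin all phases disappear and the integrand is positive. -/
theorem stft_wignerGauss_zero_ne_zero {A : Matrix (Fin d ⊕ Fin d) (Fin d ⊕ Fin d) ℝ}
    (hA : A.det ≠ 0) : stft (wignerGauss A) 0 ≠ 0 := by
  have h0 : pair (0 : Phase d).fst (-(0 : Phase d).snd) = 0 := by
    refine PiLp.ext fun i => ?_
    cases i <;> simp [pair, Phase.fst, Phase.snd]
  have h1 : pair (0 : Phase d).fst (0 : Phase d).snd = 0 := pair_fst_snd 0
  have h : stft (wignerGauss A) 0 =
      ((∫ z : Phase d, Real.exp (-(Real.pi * (‖matMap A z‖ ^ 2 + ‖z‖ ^ 2))) : ℝ) : ℂ) := by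
    refine (stft_wignerGauss hA 0 0).trans ?_
    rw [h0, h1, stft_eq, ← integral_complex_ofReal, ← integral_const_mul]
    refine integral_congr_ae (Eventually.of_forall fun z => ?_)
    have h2 : (0 : Phase d).snd = 0 := rfl
    simp only [sub_zero, inner_zero_right, mul_zero, unitExp_zero, mul_one, h2, one_mul,
      gaussWindow]
    rw [← Complex.ofReal_mul, ← Real.exp_add]
    ring_nf
  rw [h, Complex.ofReal_ne_zero]
  refine (integral_exp_pos ?_).ne'
  have hc := continuous_matMap A
  refine (integrable_exp_neg_mul_sq_norm Real.pi_pos).mono'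
    (Continuous.aestronglyMeasurable (by fun_prop)) (Eventually.of_forall fun z => ?_)
  rw [Real.norm_of_nonneg (Real.exp_pos _).le, Real.exp_le_exp, neg_le_neg_iff]
  refine mul_le_mul_of_nonneg_left ?_ Real.pi_pos.le
  linarith [sq_nonneg ‖matMap A z‖]

end Matrix

/-! ### Action of `B_A` on time-frequency shifts, and boundedness on `M¹` -/

section Expansion

open Phase

variable {d : ℕ}

theorem matMap_apply_inv {A : Matrix (Fin d ⊕ Fin d) (Fin d ⊕ Fin d) ℝ} (hA : A.det ≠ 0)
    (w : Phase d) : matMap A (matMap A⁻¹ w) = w := by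
  refine WithLp.ofLp_injective 2 ?_
  change A.mulVec (A⁻¹.mulVec w.ofLp) = w.ofLp
  rw [Matrix.mulVec_mulVec, Matrix.mul_nonsing_inv _ hA.isUnit, Matrix.one_mulVec]

theorem matMap_inv_apply {A : Matrix (Fin d ⊕ Fin d) (Fin d ⊕ Fin d) ℝ} (hA : A.det ≠ 0)
    (w : Phase d) : matMap A⁻¹ (matMap A w) = w := by
  refine WithLp.ofLp_injective 2 ?_
  change A⁻¹.mulVec (A.mulVec w.ofLp) = w.ofLp
  rw [Matrix.mulVec_mulVec, Matrix.nonsing_inv_mul _ hA.isUnit, Matrix.one_mulVec]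

theorem inner_matMap (A : Matrix (Fin d ⊕ Fin d) (Fin d ⊕ Fin d) ℝ) (z w : Phase d) :
    inner ℝ (matMap A z) w = inner ℝ z (matMap A.transpose w) := by
  simp only [EuclideanSpace.inner_eq_star_dotProduct, star_trivial]
  change w.ofLp ⬝ᵥ A.mulVec z.ofLp = A.transpose.mulVec w.ofLp ⬝ᵥ z.ofLp
  rw [Matrix.dotProduct_mulVec, Matrix.mulVec_transpose]

/-- The position part `A⁻¹ (p₁, q₁)` of the shift in `B_A(π(p) φ, π(q) φ)`. -/
def posShift (A : Matrix (Fin d ⊕ Fin d) (Fin d ⊕ Fin d) ℝ)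
    (s : (Pos d × Pos d) × (Pos d × Pos d)) : Phase d := matMap A⁻¹ (pair s.1.1 s.2.1)

/-- The frequency part `Aᵀ (p₂, -q₂)` of the shift in `B_A(π(p) φ, π(q) φ)`. -/
def freqShift (A : Matrix (Fin d ⊕ Fin d) (Fin d ⊕ Fin d) ℝ)
    (s : (Pos d × Pos d) × (Pos d × Pos d)) : Phase d := matMap A.transpose (pair s.1.2 (-s.2.2))

/-- `B_A(π(p) φ, π(q) φ)` is, up to a phase, the time-frequency shift of `B_A(φ, φ)` by
this point. -/
def wignerShift (A : Matrix (Fin d ⊕ Fin d) (Fin d ⊕ Fin d) ℝ)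
    (s : (Pos d × Pos d) × (Pos d × Pos d)) : Phase d × Phase d :=
  (pair (posShift A s).fst (freqShift A s).snd, pair (freqShift A s).fst (-(posShift A s).snd))

/-- The phase in `B_A(π(p) φ, π(q) φ)`. -/
def wignerPhase (A : Matrix (Fin d ⊕ Fin d) (Fin d ⊕ Fin d) ℝ)
    (s : (Pos d × Pos d) × (Pos d × Pos d)) : ℂ :=
  unitExp (2 * Real.pi * inner ℝ (posShift A s).snd (freqShift A s).snd)

@[fun_prop] theorem continuous_posShift (A : Matrix (Fin d ⊕ Fin d) (Fin d ⊕ Fin d) ℝ) :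
    Continuous (posShift A) := by
  have := continuous_matMap A⁻¹
  unfold posShift
  fun_prop

@[fun_prop] theorem continuous_freqShift (A : Matrix (Fin d ⊕ Fin d) (Fin d ⊕ Fin d) ℝ) :
    Continuous (freqShift A) := by
  have := continuous_matMap A.transpose
  unfold freqShift
  fun_prop

theorem continuous_wignerShift (A : Matrix (Fin d ⊕ Fin d) (Fin d ⊕ Fin d) ℝ) :
    Continuous (wignerShift A) := by
  unfold wignerShift
  fun_prop

theorem continuous_wignerPhase (A : Matrix (Fin d ⊕ Fin d) (Fin d ⊕ Fin d) ℝ) :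
    Continuous (wignerPhase A) := by
  unfold wignerPhase
  fun_prop

theorem norm_wignerPhase (A : Matrix (Fin d ⊕ Fin d) (Fin d ⊕ Fin d) ℝ)
    (s : (Pos d × Pos d) × (Pos d × Pos d)) : ‖wignerPhase A s‖ = 1 := norm_unitExp _

/-- On `ℝ^{2d}` the tensor product is one shifted Gaussian, with position `(p₁, q₁)` and frequency
`(p₂, -q₂)`, the sign coming from the conjugation. Composition with `A` pulls positions back by
`A⁻¹` and frequencies by `Aᵀ`. -/
theorem tfShift_mul_conj_tfShift {A : Matrix (Fin d ⊕ Fin d) (Fin d ⊕ Fin d) ℝ} (hA : A.det ≠ 0)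
    (s : (Pos d × Pos d) × (Pos d × Pos d)) (z : Phase d) :
    tfShift s.1 gaussWindow (matMap A z).fst *
        starRingEnd ℂ (tfShift s.2 gaussWindow (matMap A z).snd) =
      unitExp (2 * Real.pi * inner ℝ z (freqShift A s)) *
        gaussWindow (matMap A (z - posShift A s)) := by
  rw [freqShift, ← inner_matMap, map_sub, posShift, matMap_apply_inv hA, gaussWindow_eq,
    Phase.inner_eq]
  simp only [tfShift, map_mul, conj_unitExp, conj_gaussWindow, fst_sub, snd_sub, fst_pair,
    snd_pair, inner_neg_right, mul_add, unitExp_add, mul_neg]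
  ring

/-- The partial Fourier transform exchanges the second position with the second frequency;
translating `y` by the second position produces the phase. -/
theorem matrixWigner_tfShift {A : Matrix (Fin d ⊕ Fin d) (Fin d ⊕ Fin d) ℝ} (hA : A.det ≠ 0)
    (s : (Pos d × Pos d) × (Pos d × Pos d)) (z : Phase d) :
    matrixWigner A (tfShift s.1 gaussWindow) (tfShift s.2 gaussWindow) z =
      wignerPhase A s * tfShift (wignerShift A s) (wignerGauss A) z := by
  rw [matrixWigner_eq, tfShift, wignerGauss_eq, ← integral_const_mul, ← integral_const_mul,
    ← integral_add_right_eq_self (μ := volume) _ (posShift A s).snd]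
  refine integral_congr_ae (Eventually.of_forall fun y => ?_)
  beta_reduce
  rw [mul_assoc, tfShift_mul_conj_tfShift hA]
  have h1 : pair z.fst (y + (posShift A s).snd) - posShift A s =
      pair (z - (wignerShift A s).1).fst y :=
    ext_fst_snd (by simp [wignerShift]) (by simp)
  rw [h1, wignerPhase, ← mul_assoc, ← mul_assoc, ← mul_assoc, ← unitExp_add, ← unitExp_add,
    ← unitExp_add]
  congr 2
  simp only [wignerShift, Phase.inner_eq, snd_sub, fst_pair, snd_pair, inner_add_left,
    inner_sub_right, inner_neg_right, real_inner_comm (posShift A s).snd z.snd]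
  ring

/-- The majorant is the product of the two short-time Fourier transforms with a Gaussian in `y`
whose centre depends on the shifts. Its `y`-integral does not see the centre. -/
theorem matrixWigner_expansion_integrable {A : Matrix (Fin d ⊕ Fin d) (Fin d ⊕ Fin d) ℝ}
    (hA : A.det ≠ 0) {f g : Pos d → ℂ} (hf : MemM1 f) (hg : MemM1 g) (z : Phase d) :
    Integrable (fun q : Pos d × ((Pos d × Pos d) × (Pos d × Pos d)) =>
      unitExp (-2 * Real.pi * inner ℝ q.1 z.snd) *
        ((stft f q.2.1 * tfShift q.2.1 gaussWindow (matMap A (pair z.fst q.1)).fst) *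
          starRingEnd ℂ
            (stft g q.2.2 * tfShift q.2.2 gaussWindow (matMap A (pair z.fst q.1)).snd)))
      (volume.prod (volume.prod volume)) := by
  obtain ⟨ε, hε, hQ⟩ := exists_norm_gaussWindow_matMap_le hA
  have hcf := continuous_stft hf.continuous hf.norm_le
  have hcg := continuous_stft hg.continuous hg.norm_le
  have hc := continuous_matMap A
  have hbd : Integrable (fun q : Pos d × ((Pos d × Pos d) × (Pos d × Pos d)) =>
      (‖stft f q.2.1‖ * ‖stft g q.2.2‖) *
        Real.exp (-(ε * ‖q.1 - (posShift A q.2).snd‖ ^ 2)))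
      (volume.prod (volume.prod volume)) := by
    rw [integrable_prod_iff']
    · constructor
      · refine Eventually.of_forall fun s => ?_
        exact ((integrable_exp_neg_mul_sq_norm hε).comp_sub_right (posShift A s).snd).const_mul
          (‖stft f s.1‖ * ‖stft g s.2‖)
      · have h : ∀ s : (Pos d × Pos d) × (Pos d × Pos d),
            ∫ y : Pos d, Real.exp (-(ε * ‖y - (posShift A s).snd‖ ^ 2)) =
            ∫ y : Pos d, Real.exp (-(ε * ‖y‖ ^ 2)) := fun s =>
          integral_sub_right_eq_self (fun y : Pos d => Real.exp (-(ε * ‖y‖ ^ 2))) _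
        simp only [norm_mul, norm_norm, Real.norm_of_nonneg (Real.exp_pos _).le,
          integral_const_mul, h]
        exact (hf.integrable_stft.norm.mul_prod hg.integrable_stft.norm).mul_const _
    · exact Continuous.aestronglyMeasurable (by fun_prop)
  refine hbd.mono' (Continuous.aestronglyMeasurable ?_) (Eventually.of_forall fun q => ?_)
  · unfold tfShift
    fun_prop
  · have h1 : (stft f q.2.1 * tfShift q.2.1 gaussWindow (matMap A (pair z.fst q.1)).fst) *
          starRingEnd ℂ
            (stft g q.2.2 * tfShift q.2.2 gaussWindow (matMap A (pair z.fst q.1)).snd) =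
        (stft f q.2.1 * starRingEnd ℂ (stft g q.2.2)) *
          (unitExp (2 * Real.pi * inner ℝ (pair z.fst q.1) (freqShift A q.2)) *
            gaussWindow (matMap A (pair z.fst q.1 - posShift A q.2))) := by
      rw [← tfShift_mul_conj_tfShift hA, map_mul]
      ring
    rw [h1, norm_mul, norm_unitExp, one_mul, norm_mul, norm_mul, norm_mul, norm_unitExp, one_mul,
      RCLike.norm_conj]
    exact mul_le_mul_of_nonneg_left (hQ _) (by positivity)

theorem matrixWigner_expansion_fiber {A : Matrix (Fin d ⊕ Fin d) (Fin d ⊕ Fin d) ℝ}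
    {f g : Pos d → ℂ} (hf : MemM1 f) (hg : MemM1 g) (z : Phase d) (y : Pos d) :
    ∫ s : (Pos d × Pos d) × (Pos d × Pos d), unitExp (-2 * Real.pi * inner ℝ y z.snd) *
        ((stft f s.1 * tfShift s.1 gaussWindow (matMap A (pair z.fst y)).fst) *
          starRingEnd ℂ (stft g s.2 * tfShift s.2 gaussWindow (matMap A (pair z.fst y)).snd)) =
      (unitExp (-2 * Real.pi * inner ℝ y z.snd) * f (matMap A (pair z.fst y)).fst *
        starRingEnd ℂ (g (matMap A (pair z.fst y)).snd)) * (gaussNormSq (Fin d) : ℂ) ^ 2 := by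
  rw [integral_const_mul, Measure.volume_eq_prod,
    integral_prod_mul (fun p => stft f p * tfShift p gaussWindow (matMap A (pair z.fst y)).fst)
      (fun q => starRingEnd ℂ (stft g q * tfShift q gaussWindow (matMap A (pair z.fst y)).snd)),
    integral_conj, hf.expansion, hg.expansion, map_mul, Complex.conj_ofReal]
  ring

theorem gaussNormSq_sq_ne_zero : (gaussNormSq (Fin d) : ℂ) ^ 2 ≠ 0 :=
  pow_ne_zero _ (by exact_mod_cast gaussNormSq_pos.ne')

/-- The blocks of `A` may be singular, so neither factor need decay in `y` by itself. Integrability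
of the product comes from integrating the absolutely convergent double expansion over the shifts. -/
theorem integrable_matrixWigner_integrand {A : Matrix (Fin d ⊕ Fin d) (Fin d ⊕ Fin d) ℝ}
    (hA : A.det ≠ 0) {f g : Pos d → ℂ} (hf : MemM1 f) (hg : MemM1 g) (z : Phase d) :
    Integrable fun y : Pos d => unitExp (-2 * Real.pi * inner ℝ y z.snd) *
      f (matMap A (pair z.fst y)).fst * starRingEnd ℂ (g (matMap A (pair z.fst y)).snd) := by
  have h := (matrixWigner_expansion_integrable hA hf hg z).integral_prod_left
  rw [← Measure.volume_eq_prod] at h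
  simp only [matrixWigner_expansion_fiber hf hg] at h
  refine (h.mul_const ((gaussNormSq (Fin d) : ℂ) ^ 2)⁻¹).congr (Eventually.of_forall fun y => ?_)
  beta_reduce
  rw [mul_assoc _ (_ ^ 2), mul_inv_cancel₀ gaussNormSq_sq_ne_zero, mul_one]

/-- The coefficient of `B_A(f, g)` with respect to the shifts of `B_A(φ, φ)`. -/
def wignerCoeff (A : Matrix (Fin d ⊕ Fin d) (Fin d ⊕ Fin d) ℝ) (f g : Pos d → ℂ)
    (s : (Pos d × Pos d) × (Pos d × Pos d)) : ℂ :=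
  ((gaussNormSq (Fin d) : ℂ) ^ 2)⁻¹ * (wignerPhase A s * (stft f s.1 * starRingEnd ℂ (stft g s.2)))

/-- Fubini between `y` and the pair of shifts: one order of integration recovers `B_A(f, g)` times
the squared constant of the expansion, the other yields `B_A` of shifted Gaussians. -/
theorem matrixWigner_expansion {A : Matrix (Fin d ⊕ Fin d) (Fin d ⊕ Fin d) ℝ}
    (hA : A.det ≠ 0) {f g : Pos d → ℂ} (hf : MemM1 f) (hg : MemM1 g) (z : Phase d) :
    matrixWigner A f g z =
      ∫ s, wignerCoeff A f g s * tfShift (wignerShift A s) (wignerGauss A) z := by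
  have h := integral_integral_swap (f := fun (y : Pos d) (s : (Pos d × Pos d) × (Pos d × Pos d)) =>
    unitExp (-2 * Real.pi * inner ℝ y z.snd) *
      ((stft f s.1 * tfShift s.1 gaussWindow (matMap A (pair z.fst y)).fst) *
        starRingEnd ℂ (stft g s.2 * tfShift s.2 gaussWindow (matMap A (pair z.fst y)).snd)))
    (matrixWigner_expansion_integrable hA hf hg z)
  rw [← Measure.volume_eq_prod] at h
  simp only [matrixWigner_expansion_fiber hf hg, integral_mul_const, ← matrixWigner_eq] at h
  rw [eq_comm, ← mul_left_inj' gaussNormSq_sq_ne_zero, h, ← integral_mul_const]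
  refine integral_congr_ae (Eventually.of_forall fun s => ?_)
  beta_reduce
  calc _ = (stft f s.1 * starRingEnd ℂ (stft g s.2)) *
        (wignerPhase A s * tfShift (wignerShift A s) (wignerGauss A) z) := by
        rw [wignerCoeff]
        linear_combination (wignerPhase A s * (stft f s.1 * starRingEnd ℂ (stft g s.2)) *
          tfShift (wignerShift A s) (wignerGauss A) z) *
          inv_mul_cancel₀ (gaussNormSq_sq_ne_zero (d := d))
    _ = _ := by
        rw [← matrixWigner_tfShift hA, matrixWigner_eq, ← integral_const_mul]
        refine integral_congr_ae (Eventually.of_forall fun y => ?_)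
        simp only [map_mul]
        ring

theorem integrable_wignerCoeff {A : Matrix (Fin d ⊕ Fin d) (Fin d ⊕ Fin d) ℝ}
    {f g : Pos d → ℂ} (hf : MemM1 f) (hg : MemM1 g) : Integrable (wignerCoeff A f g) := by
  refine Integrable.const_mul ?_ _
  rw [Measure.volume_eq_prod]
  have h : Integrable (fun s : (Pos d × Pos d) × (Pos d × Pos d) =>
      stft f s.1 * starRingEnd ℂ (stft g s.2)) (volume.prod volume) :=
    hf.integrable_stft.mul_prod ((Complex.conjCLE : ℂ →L[ℝ] ℂ).integrable_comp hg.integrable_stft)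
  exact h.bdd_mul (c := 1) (continuous_wignerPhase A).aestronglyMeasurable
    (Eventually.of_forall fun s => (norm_wignerPhase A s).le)

theorem integral_norm_wignerCoeff (A : Matrix (Fin d ⊕ Fin d) (Fin d ⊕ Fin d) ℝ)
    (f g : Pos d → ℂ) : ∫ s, ‖wignerCoeff A f g s‖ =
      (gaussNormSq (Fin d) ^ 2)⁻¹ * ((∫ p, ‖stft f p‖) * ∫ q, ‖stft g q‖) := by
  simp only [wignerCoeff, norm_mul, norm_wignerPhase, one_mul, RCLike.norm_conj, norm_inv, norm_pow,
    Complex.norm_real, Real.norm_of_nonneg gaussNormSq_pos.le]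
  rw [integral_const_mul, Measure.volume_eq_prod,
    integral_prod_mul (fun p => ‖stft f p‖) (fun q => ‖stft g q‖)]

/-- `B_A` maps `M¹ × M¹` into `M¹`, boundedly. -/
theorem memM1_matrixWigner {A : Matrix (Fin d ⊕ Fin d) (Fin d ⊕ Fin d) ℝ} (hA : A.det ≠ 0)
    {f g : Pos d → ℂ} (hf : MemM1 f) (hg : MemM1 g) :
    MemM1 (matrixWigner A f g) ∧ ∫ p, ‖stft (matrixWigner A f g) p‖ ≤
      (gaussNormSq (Fin d) ^ 2)⁻¹ * ((∫ p, ‖stft f p‖) * ∫ q, ‖stft g q‖) *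
        ∫ p, ‖stft (wignerGauss A) p‖ := by
  obtain ⟨hGc, C, hGC⟩ := wignerGauss_bounded hA
  have h := memM1_synthesis (integrable_wignerCoeff (A := A) hf hg)
    (continuous_wignerShift A).measurable hGc hGC (integrable_stft_wignerGauss hA)
    (matrixWigner_expansion hA hf hg)
  exact ⟨h.1, integral_norm_wignerCoeff A f g ▸ h.2.2⟩

end Expansion

/-! ### Functionals on `M¹` are determined by the shifts of one window -/

section Density

variable {ι : Type*} [Fintype ι]

/-- Integration over a fixed measurable set is a continuous functional on `L¹`, so it commutes with
the Bochner integral; Fubini then identifies the set integrals of both sides. -/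
theorem coeFn_integral_toL1_ae_eq {X Y : Type*} [MeasurableSpace X] [MeasurableSpace Y]
    {μ : Measure X} [SFinite μ] {ν : Measure Y} [SFinite ν] {Φ : X → Y →₁[ν] ℂ} {φ : X → Y → ℂ}
    (hΦ : Integrable Φ μ) (h : ∀ s, Φ s =ᵐ[ν] φ s)
    (hφ : Integrable (fun q : Y × X => φ q.2 q.1) (ν.prod μ)) :
    (↑(∫ s, Φ s ∂μ) : Y → ℂ) =ᵐ[ν] fun y => ∫ s, φ s y ∂μ := by
  refine Integrable.ae_eq_of_forall_setIntegral_eq _ _ (L1.integrable_coeFn _)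
    hφ.integral_prod_left fun S hS hfin => ?_
  let l : (Y →₁[ν] ℂ) →L[ℂ] ℂ :=
    { toFun := fun u => ∫ y in S, u y ∂ν
      map_add' := fun u v => by
        rw [← integral_add (L1.integrable_coeFn u).integrableOn
          (L1.integrable_coeFn v).integrableOn]
        exact integral_congr_ae (ae_restrict_of_ae (Lp.coeFn_add u v))
      map_smul' := fun c u => by
        rw [RingHom.id_apply, smul_eq_mul, ← integral_const_mul]
        exact integral_congr_ae (ae_restrict_of_ae (Lp.coeFn_smul c u))
      cont := continuous_setIntegral S }
  have h1 : l (∫ s, Φ s ∂μ) = ∫ s, l (Φ s) ∂μ := (l.integral_comp_comm hΦ).symm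
  have h2 : ∀ s, l (Φ s) = ∫ y in S, φ s y ∂ν := fun s =>
    integral_congr_ae (ae_restrict_of_ae (h s))
  have h3 : Integrable (fun q : Y × X => φ q.2 q.1) ((ν.restrict S).prod μ) :=
    hφ.mono_measure (Measure.prod_mono Measure.restrict_le_self le_rfl)
  calc _ = ∫ s, (∫ y in S, φ s y ∂ν) ∂μ := by
        rw [← funext h2]
        exact h1
    _ = _ := (integral_integral_swap (f := fun y s => φ s y) h3).symm

/-- The isometric embedding `f ↦ V_φ f` of `M¹` into `L¹`. -/
def M1.toL1 : M1 ι →ₗᵢ[ℂ] (EuclideanSpace ℝ ι × EuclideanSpace ℝ ι) →₁[volume] ℂ where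
  toFun f := f.memM1.integrable_stft.toL1 (stft f.toFun)
  map_add' f g := by
    rw [← Integrable.toL1_add, Integrable.toL1_eq_toL1_iff]
    exact Eventually.of_forall (congrFun (stft_add f.memM1.memLp g.memM1.memLp))
  map_smul' c f := by
    rw [RingHom.id_apply, ← Integrable.toL1_smul', Integrable.toL1_eq_toL1_iff]
    exact Eventually.of_forall (congrFun (stft_smul c f.toFun))
  norm_map' f := L1.norm_of_fun_eq_integral_norm f.memM1.integrable_stft

theorem M1.coeFn_toL1 (f : M1 ι) : M1.toL1 f =ᵐ[volume] stft f.toFun :=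
  Integrable.coeFn_toL1 f.memM1.integrable_stft

theorem M1.norm_toL1_sub (f g : M1 ι) :
    ‖M1.toL1 f - M1.toL1 g‖ = ∫ p, ‖stft f.toFun p - stft g.toFun p‖ := by
  change ‖f.memM1.integrable_stft.toL1 (stft f.toFun) -
    g.memM1.integrable_stft.toL1 (stft g.toFun)‖ = _
  rw [← Integrable.toL1_sub, L1.norm_of_fun_eq_integral_norm]
  rfl

theorem MemM1.tfShift {G : EuclideanSpace ℝ ι → ℂ} (hG : MemM1 G)
    (r : EuclideanSpace ℝ ι × EuclideanSpace ℝ ι) : MemM1 (tfShift r G) :=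
  memM1_of_bounded (hG.continuous.tfShift r) (fun t => (norm_tfShift r G t).trans_le (hG.norm_le _))
    (integrable_stft_tfShift hG.continuous hG.norm_le hG.integrable_stft r)

/-- The time-frequency shift of an element of `M¹`. -/
def M1.tfShift (r : EuclideanSpace ℝ ι × EuclideanSpace ℝ ι) (G : M1 ι) : M1 ι :=
  M1.mk (_root_.tfShift r G.toFun) (G.memM1.tfShift r)

theorem continuous_stft_tfShift {G : EuclideanSpace ℝ ι → ℂ} (hG : MemM1 G)
    (p : EuclideanSpace ℝ ι × EuclideanSpace ℝ ι) : Continuous fun r => stft (tfShift r G) p := by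
  have hcs := continuous_stft hG.continuous hG.norm_le
  simp only [stft_tfShift]
  fun_prop

theorem half_sq_norm_sub_one_le {E : Type*} [NormedAddCommGroup E] {u v w : E}
    (h : ‖v - w‖ ≤ 1) : ‖u - w‖ ^ 2 / 2 - 1 ≤ ‖u - v‖ ^ 2 := by
  have h1 : ‖u - w‖ ≤ ‖u - v‖ + ‖v - w‖ := norm_sub_le_norm_sub_add_norm_sub _ _ _
  have h2 : ‖u - w‖ ^ 2 ≤ (‖u - v‖ + 1) ^ 2 := by
    gcongr
    linarith
  nlinarith [sq_nonneg (‖u - v‖ - 1)]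

/-- Dominated convergence: Gaussian decay supplies one majorant for all shifts within distance 1 of
`r₀`. -/
theorem M1.continuous_toL1_tfShift (G : M1 ι) {C ε : ℝ} (hε : 0 < ε)
    (h : ∀ p, ‖stft G.toFun p‖ ≤ C * Real.exp (-(ε * (‖p.1‖ ^ 2 + ‖p.2‖ ^ 2)))) :
    Continuous fun r => M1.toL1 (G.tfShift r) := by
  have hC : 0 ≤ C := by
    have := (norm_nonneg _).trans (h 0)
    exact nonneg_of_mul_nonneg_left this (Real.exp_pos _)
  rw [continuous_iff_continuousAt]
  intro r₀
  -- Recentring by `half_sq_norm_sub_one_le` halves the exponent and loses `ε` in each of the two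
  -- components, whence `exp (2 * ε)`.
  let bd : EuclideanSpace ℝ ι × EuclideanSpace ℝ ι → ℝ := fun p =>
    C * Real.exp (2 * ε) * Real.exp (-(ε / 2 * (‖p.1 - r₀.1‖ ^ 2 + ‖p.2 - r₀.2‖ ^ 2)))
  have hbd : Integrable bd :=
    ((integrable_exp_neg_mul_add_sq_norm (half_pos hε)).comp_sub_right r₀).const_mul _
  have hle : ∀ r ∈ Metric.ball r₀ 1, ∀ p, ‖stft (_root_.tfShift r G.toFun) p‖ ≤ bd p :=
    fun r hr p => by
      rw [norm_stft_tfShift]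
      refine (h _).trans ?_
      change _ ≤ C * Real.exp (2 * ε) *
        Real.exp (-(ε / 2 * (‖p.1 - r₀.1‖ ^ 2 + ‖p.2 - r₀.2‖ ^ 2)))
      rw [mul_assoc, ← Real.exp_add]
      refine mul_le_mul_of_nonneg_left (Real.exp_le_exp.2 ?_) hC
      have hr' : ‖r - r₀‖ ≤ 1 := by
        rw [← dist_eq_norm]
        exact (Metric.mem_ball.1 hr).le
      have e1 := half_sq_norm_sub_one_le (u := p.1) ((norm_fst_le (r - r₀)).trans hr')
      have e2 := half_sq_norm_sub_one_le (u := p.2) ((norm_snd_le (r - r₀)).trans hr')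
      simp only [Prod.fst_sub, Prod.snd_sub]
      nlinarith
  have hcont : ContinuousAt (fun r => ∫ p, ‖stft (_root_.tfShift r G.toFun) p -
      stft (_root_.tfShift r₀ G.toFun) p‖) r₀ := by
    refine continuousAt_of_dominated (bound := fun p => bd p + bd p) ?_ ?_ (hbd.add hbd) ?_
    · refine Eventually.of_forall fun r => ?_
      exact ((G.tfShift r).memM1.integrable_stft.sub
        (G.tfShift r₀).memM1.integrable_stft).norm.aestronglyMeasurable
    · filter_upwards [Metric.ball_mem_nhds r₀ one_pos] with r hr
      refine Eventually.of_forall fun p => ?_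
      rw [norm_norm]
      exact (norm_sub_le _ _).trans
        (add_le_add (hle r hr p) (hle r₀ (Metric.mem_ball_self one_pos) p))
    · refine Eventually.of_forall fun p => ?_
      exact ((continuous_stft_tfShift G.memM1 p).sub continuous_const).norm.continuousAt
  rw [ContinuousAt, tendsto_iff_norm_sub_tendsto_zero]
  have h2 := hcont.tendsto
  simp only [sub_self, norm_zero, integral_zero] at h2
  refine h2.congr fun r => ?_
  rw [M1.norm_toL1_sub]
  rfl

/-- A functional vanishing on all time-frequency shifts of a suitable window vanishes. -/
theorem MInfty.eq_zero_of_tfShift {σ : MInfty ι} (G : M1 ι) {C ε : ℝ} (hε : 0 < ε)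
    (h : ∀ p, ‖stft G.toFun p‖ ≤ C * Real.exp (-(ε * (‖p.1‖ ^ 2 + ‖p.2‖ ^ 2))))
    (h0 : stft G.toFun 0 ≠ 0) (hσ : ∀ r, σ (G.tfShift r) = 0) : σ = 0 := by
  ext H
  let K : Submodule ℂ (M1 ι) := LinearMap.ker σ.toLinearMap
  have hK : IsClosed (K : Set (M1 ι)) := isClosed_singleton.preimage σ.continuous
  -- The superposition of shifts is formed in the complete space `L¹` and only afterwards brought
  -- back to `M¹`.
  let N := (K.map M1.toL1.toLinearMap).topologicalClosure
  have hN : IsClosed (N : Set ((EuclideanSpace ℝ ι × EuclideanSpace ℝ ι) →₁[volume] ℂ)) :=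
    Submodule.isClosed_topologicalClosure _
  have hcont := G.continuous_toL1_tfShift hε h
  let Φ : EuclideanSpace ℝ ι × EuclideanSpace ℝ ι →
      (EuclideanSpace ℝ ι × EuclideanSpace ℝ ι) →₁[volume] ℂ :=
    fun r => stft H.toFun r • M1.toL1 (G.tfShift r)
  have hHs := H.memM1.integrable_stft
  have hΦ : Integrable Φ := by
    refine hHs.smul_bdd ‖G‖ hcont.aestronglyMeasurable (Eventually.of_forall fun r => ?_)
    rw [LinearIsometry.norm_map]
    exact (integral_norm_stft_tfShift r G.toFun).le
  have hΦN : ∀ r, Φ r ∈ N := fun r =>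
    N.smul_mem _ (Submodule.le_topologicalClosure _ ⟨_, hσ r, rfl⟩)
  -- The quotient map modulo `N` annihilates the integrand, hence also the integral.
  have hmem : ∫ r, Φ r ∈ N := by
    have h1 := (N.mkQL).integral_comp_comm hΦ
    have h2 : ∀ r, N.mkQL (Φ r) = 0 := fun r => (Submodule.Quotient.mk_eq_zero N).2 (hΦN r)
    simp only [h2, integral_zero] at h1
    exact (Submodule.Quotient.mk_eq_zero N).1 h1.symm
  have hsyn := memM1_synthesis hHs measurable_id G.memM1.continuous G.memM1.norm_le
    G.memM1.integrable_stft (fun t => rfl)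
  have hΦe : (∫ r, Φ r) = M1.toL1 (M1.mk _ hsyn.1) := by
    refine Lp.ext ?_
    refine (coeFn_integral_toL1_ae_eq hΦ (φ := fun r p => stft H.toFun r *
      stft (_root_.tfShift r G.toFun) p) (fun r => ?_) ?_).trans ?_
    · filter_upwards [Lp.coeFn_smul (stft H.toFun r) (M1.toL1 (G.tfShift r)),
        M1.coeFn_toL1 (G.tfShift r)] with p h1 h2
      rw [h1, Pi.smul_apply, h2]
      rfl
    · exact integrable_mul_stft_tfShift hHs measurable_id G.memM1.continuous G.memM1.norm_le
        G.memM1.integrable_stft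
    · refine EventuallyEq.trans (Eventually.of_forall fun p => ?_) (M1.coeFn_toL1 _).symm
      exact (hsyn.2.1 p).symm
  -- Inversion with synthesis window `G`: the constant `∫ φ G` is the value of `stft G` at the
  -- origin, which is why `h0` is required.
  have hc : M1.mk _ hsyn.1 = stft G.toFun 0 • H := by
    refine M1.ext' (funext fun t => ?_)
    refine (stft_inversion H.memM1.continuous H.memM1.integrable_mul_gaussWindow hHs
      G.memM1.continuous G.memM1.norm_le t).trans ?_
    rw [mul_comm]
    congr 1
    rw [stft_eq]
    refine integral_congr_ae (Eventually.of_forall fun y => ?_)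
    simp [mul_comm]
  rw [hΦe, hc] at hmem
  -- The embedding is isometric, so closeness to the image of `K` in `L¹` is closeness to `K` in
  -- `M¹`.
  have hcl : stft G.toFun 0 • H ∈ closure (K : Set (M1 ι)) := by
    rw [M1.toL1.isometry.isUniformInducing.isInducing.closure_eq_preimage_closure_image]
    exact hmem
  rw [hK.closure_eq] at hcl
  have h3 : σ (stft G.toFun 0 • H) = 0 := hcl
  rw [map_smulₛₗ, smul_eq_zero, map_eq_zero] at h3
  exact h3.resolve_left h0

end Density

/-! ### Operators `σ^A`: existence, adjoints, uniqueness of symbol and matrix -/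

section Quantization

open Phase

variable {d : ℕ} {A B : Matrix (Fin d ⊕ Fin d) (Fin d ⊕ Fin d) ℝ}

/-- `B_A(f, g)` as an element of `M¹`. -/
def M1.wigner (hA : A.det ≠ 0) (f g : M1 (Fin d)) : M1 (Fin d ⊕ Fin d) :=
  M1.mk (matrixWigner A f.toFun g.toFun) (memM1_matrixWigner hA f.memM1 g.memM1).1

theorem M1.wigner_add_left (hA : A.det ≠ 0) (f f' g : M1 (Fin d)) :
    M1.wigner hA (f + f') g = M1.wigner hA f g + M1.wigner hA f' g := by
  refine M1.ext' (funext fun z => ?_)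
  change matrixWigner A (f.toFun + f'.toFun) g.toFun z =
    matrixWigner A f.toFun g.toFun z + matrixWigner A f'.toFun g.toFun z
  simp only [matrixWigner_eq]
  rw [← integral_add (integrable_matrixWigner_integrand hA f.memM1 g.memM1 z)
    (integrable_matrixWigner_integrand hA f'.memM1 g.memM1 z)]
  refine integral_congr_ae (Eventually.of_forall fun y => ?_)
  simp only [Pi.add_apply]
  ring

theorem M1.wigner_add_right (hA : A.det ≠ 0) (f g g' : M1 (Fin d)) :
    M1.wigner hA f (g + g') = M1.wigner hA f g + M1.wigner hA f g' := by
  refine M1.ext' (funext fun z => ?_)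
  change matrixWigner A f.toFun (g.toFun + g'.toFun) z =
    matrixWigner A f.toFun g.toFun z + matrixWigner A f.toFun g'.toFun z
  simp only [matrixWigner_eq]
  rw [← integral_add (integrable_matrixWigner_integrand hA f.memM1 g.memM1 z)
    (integrable_matrixWigner_integrand hA f.memM1 g'.memM1 z)]
  refine integral_congr_ae (Eventually.of_forall fun y => ?_)
  simp only [Pi.add_apply, map_add]
  ring

theorem M1.wigner_smul_left (hA : A.det ≠ 0) (c : ℂ) (f g : M1 (Fin d)) :
    M1.wigner hA (c • f) g = c • M1.wigner hA f g := by
  refine M1.ext' (funext fun z => ?_)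
  change matrixWigner A (c • f.toFun) g.toFun z = c * matrixWigner A f.toFun g.toFun z
  simp only [matrixWigner_eq]
  rw [← integral_const_mul]
  refine integral_congr_ae (Eventually.of_forall fun y => ?_)
  simp only [Pi.smul_apply, smul_eq_mul]
  ring

theorem M1.wigner_smul_right (hA : A.det ≠ 0) (c : ℂ) (f g : M1 (Fin d)) :
    M1.wigner hA f (c • g) = starRingEnd ℂ c • M1.wigner hA f g := by
  refine M1.ext' (funext fun z => ?_)
  change matrixWigner A f.toFun (c • g.toFun) z =
    starRingEnd ℂ c * matrixWigner A f.toFun g.toFun z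
  simp only [matrixWigner_eq]
  rw [← integral_const_mul]
  refine integral_congr_ae (Eventually.of_forall fun y => ?_)
  simp only [Pi.smul_apply, smul_eq_mul, map_mul]
  ring

theorem M1.norm_wigner_le (hA : A.det ≠ 0) (f g : M1 (Fin d)) :
    ‖M1.wigner hA f g‖ ≤
      (gaussNormSq (Fin d) ^ 2)⁻¹ * (‖f‖ * ‖g‖) * ∫ p, ‖stft (wignerGauss A) p‖ :=
  (memM1_matrixWigner hA f.memM1 g.memM1).2

/-- Conjugate-linearity of `σ` cancels that of `B_A(g, f)` in `f`, and the bound on `B_A` gives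
continuity. -/
theorem exists_isQuantization (hA : A.det ≠ 0) (σ : MInfty (Fin d ⊕ Fin d)) :
    ∃ T : M1Operator d, IsQuantization A σ T := by
  refine ⟨LinearMap.mkContinuous₂ (LinearMap.mk₂'ₛₗ (RingHom.id ℂ) (starRingEnd ℂ)
      (fun f g => σ (M1.wigner hA g f))
      (fun f₁ f₂ g => by rw [M1.wigner_add_right, map_add])
      (fun c f g => by
        rw [M1.wigner_smul_right, map_smulₛₗ, Complex.conj_conj, RingHom.id_apply])
      (fun f g₁ g₂ => by rw [M1.wigner_add_left, map_add])
      (fun c f g => by rw [M1.wigner_smul_left, map_smulₛₗ]))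
    (‖σ‖ * ((gaussNormSq (Fin d) ^ 2)⁻¹ * ∫ p, ‖stft (wignerGauss A) p‖)) fun f g => ?_,
    fun f g => ⟨(memM1_matrixWigner hA g.memM1 f.memM1).1, rfl⟩⟩
  refine (σ.le_opNorm _).trans ((mul_le_mul_of_nonneg_left (M1.norm_wigner_le hA g f)
    (norm_nonneg σ)).trans_eq ?_)
  ring

theorem isQuantization_quantize (hA : A.det ≠ 0) (σ : MInfty (Fin d ⊕ Fin d)) :
    IsQuantization A σ (quantize A σ) := by
  have h := exists_isQuantization hA σ
  rw [quantize, dif_pos h]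
  exact h.choose_spec

theorem quantize_apply (hA : A.det ≠ 0) (σ : MInfty (Fin d ⊕ Fin d)) (f g : M1 (Fin d)) :
    quantize A σ f g = σ (M1.wigner hA g f) :=
  (isQuantization_quantize hA σ f g).2

theorem matAct_neg_left (P : Matrix (Fin d) (Fin d) ℝ) (x : Pos d) :
    matAct (-P) x = matAct P (-x) := by
  refine WithLp.ofLp_injective 2 ?_
  change (-P).mulVec x.ofLp = P.mulVec (-x.ofLp)
  rw [Matrix.neg_mulVec, Matrix.mulVec_neg]

/-- Conjugation exchanges the two factors, hence the block rows, and inverts the exponential; `y ↦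
-y` restores the exponential at the cost of the signs in the second block column. -/
theorem conj_matrixWigner_fromBlocks (f g : Pos d → ℂ) (z : Phase d) :
    starRingEnd ℂ (matrixWigner (Matrix.fromBlocks A.toBlocks₂₁ (-A.toBlocks₂₂) A.toBlocks₁₁
      (-A.toBlocks₁₂)) g f z) = matrixWigner A f g z := by
  rw [matrixWigner, matrixWigner, ← integral_conj, ← integral_neg_eq_self]
  refine integral_congr_ae (Eventually.of_forall fun y => ?_)
  simp only [Matrix.toBlocks_fromBlocks₁₁, Matrix.toBlocks_fromBlocks₁₂,
    Matrix.toBlocks_fromBlocks₂₁, Matrix.toBlocks_fromBlocks₂₂, matAct_neg_left, neg_neg,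
    map_mul, Complex.conj_conj, ← unitExp.eq_1, conj_unitExp, inner_neg_left, mul_neg]
  ring

/-- Both brackets at `f, g` equal `conj ⟨σ, B_A(f, g)⟩`, because `B_A(f, g) = conj B_B(g, f)`. -/
theorem adj_quantize (hA : A.det ≠ 0) (hB : B.det ≠ 0)
    (hBA : B = Matrix.fromBlocks A.toBlocks₂₁ (-A.toBlocks₂₂) A.toBlocks₁₁ (-A.toBlocks₁₂))
    (σ : MInfty (Fin d ⊕ Fin d)) : (quantize A σ).adj = quantize B σ.conj := by
  ext f g
  rw [quantize_apply hB]
  change starRingEnd ℂ (quantize A σ g f) = starRingEnd ℂ (σ (M1.wigner hB g f).conj)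
  rw [quantize_apply hA]
  congr 2
  refine M1.ext' (funext fun z => ?_)
  subst hBA
  exact (conj_matrixWigner_fromBlocks f.toFun g.toFun z).symm

theorem memM1_gaussWindow {ι : Type*} [Fintype ι] :
    MemM1 (gaussWindow : EuclideanSpace ℝ ι → ℂ) := by
  obtain ⟨C, ε, hε, h⟩ := exists_norm_stft_gaussWindow_comp_le
    (LinearMap.id : EuclideanSpace ℝ ι →ₗ[ℝ] EuclideanSpace ℝ ι) Function.injective_id
  refine memM1_of_bounded continuous_gaussWindow norm_gaussWindow_le_one ?_
  exact ((integrable_exp_neg_mul_add_sq_norm hε).const_mul C).mono'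
    (continuous_stft continuous_gaussWindow norm_gaussWindow_le_one).aestronglyMeasurable
    (Eventually.of_forall h)

/-- The Gaussian window as an element of `M¹`. -/
def M1.gauss (ι : Type*) [Fintype ι] : M1 ι := M1.mk gaussWindow memM1_gaussWindow

/-- `B_A(φ, φ)` as an element of `M¹`. -/
def M1.wignerGauss (hA : A.det ≠ 0) : M1 (Fin d ⊕ Fin d) :=
  M1.wigner hA (M1.gauss (Fin d)) (M1.gauss (Fin d))

theorem M1.wigner_tfShift_gauss (hA : A.det ≠ 0) (s : (Pos d × Pos d) × (Pos d × Pos d)) :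
    M1.wigner hA ((M1.gauss (Fin d)).tfShift s.1) ((M1.gauss (Fin d)).tfShift s.2) =
      wignerPhase A s • (M1.wignerGauss hA).tfShift (wignerShift A s) :=
  M1.ext' (funext fun z => matrixWigner_tfShift hA s z)

/-- Positions and frequencies of the two Gaussians enter separately, through the invertible matrices
`A⁻¹` and `Aᵀ`, and can be solved for independently. -/
theorem wignerShift_surjective (hA : A.det ≠ 0) : Function.Surjective (wignerShift A) := by
  rintro ⟨z, ζ⟩
  have hAt : A.transpose.det ≠ 0 := by rwa [Matrix.det_transpose]
  let w : Phase d := matMap A (pair z.fst (-ζ.snd))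
  let v : Phase d := matMap A.transpose⁻¹ (pair ζ.fst z.snd)
  refine ⟨((w.fst, v.fst), (w.snd, -v.snd)), ?_⟩
  have h1 : posShift A ((w.fst, v.fst), (w.snd, -v.snd)) = pair z.fst (-ζ.snd) := by
    rw [posShift, pair_fst_snd, matMap_inv_apply hA]
  have h2 : freqShift A ((w.fst, v.fst), (w.snd, -v.snd)) = pair ζ.fst z.snd := by
    rw [freqShift, neg_neg, pair_fst_snd, matMap_apply_inv hAt]
  rw [wignerShift, h1, h2, fst_pair, snd_pair, fst_pair, snd_pair, neg_neg, pair_fst_snd,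
    pair_fst_snd]

/-- The symbol of an operator is uniquely determined. -/
theorem quantize_injective (hA : A.det ≠ 0) : Function.Injective (quantize A) := by
  intro σ τ h
  rw [← sub_eq_zero]
  obtain ⟨C, ε, hε, hC⟩ := exists_norm_stft_wignerGauss_le hA
  refine MInfty.eq_zero_of_tfShift (M1.wignerGauss hA) hε hC (stft_wignerGauss_zero_ne_zero hA)
    fun r => ?_
  obtain ⟨s, rfl⟩ := wignerShift_surjective hA r
  have h1 := quantize_apply hA σ ((M1.gauss (Fin d)).tfShift s.2) ((M1.gauss (Fin d)).tfShift s.1)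
  rw [h, quantize_apply hA, M1.wigner_tfShift_gauss, map_smulₛₗ, map_smulₛₗ] at h1
  have h2 : starRingEnd ℂ (wignerPhase A s) ≠ 0 := by
    rw [Ne, map_eq_zero, ← norm_eq_zero, norm_wignerPhase]
    exact one_ne_zero
  rw [sub_apply, sub_eq_zero]
  exact (smul_right_injective ℂ h2 h1).symm

/-- The point evaluation `F ↦ conj (F z)`. -/
def MInfty.eval {ι : Type*} [Fintype ι] (z : EuclideanSpace ℝ ι) : MInfty ι :=
  LinearMap.mkContinuous
    { toFun := fun F => starRingEnd ℂ (F.toFun z)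
      map_add' := fun F G => map_add (starRingEnd ℂ) (F.toFun z) (G.toFun z)
      map_smul' := fun c F => map_mul (starRingEnd ℂ) c (F.toFun z) }
    (gaussNormSq ι)⁻¹ fun F => (RCLike.norm_conj _).trans_le (F.memM1.norm_le z)

theorem MInfty.conj_eval {ι : Type*} [Fintype ι] (z : EuclideanSpace ℝ ι) :
    (MInfty.eval z).conj = MInfty.eval z := by
  ext F
  change starRingEnd ℂ (starRingEnd ℂ (starRingEnd ℂ (F.toFun z))) = starRingEnd ℂ (F.toFun z)
  rw [Complex.conj_conj]

/-- Along the multiples `k • τ` the norm stays equal to `‖h 0‖`, while the decay forces it to zero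
unless `τ = 0`. -/
theorem eq_zero_of_periodic {E F : Type*} [NormedAddCommGroup E] [NormedAddCommGroup F]
    [NormedSpace ℝ E] {h : E × E → F} {C ε : ℝ} (hε : 0 < ε)
    (hC : ∀ p, ‖h p‖ ≤ C * Real.exp (-(ε * (‖p.1‖ ^ 2 + ‖p.2‖ ^ 2)))) (h0 : h 0 ≠ 0)
    {τ : E × E} (hτ : ∀ p, ‖h (p + τ)‖ = ‖h p‖) : τ = 0 := by
  by_contra hne
  have hpos : 0 < ‖τ.1‖ ^ 2 + ‖τ.2‖ ^ 2 := by
    by_contra hle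
    have h1 : ‖τ.1‖ = 0 := by nlinarith [sq_nonneg ‖τ.1‖, sq_nonneg ‖τ.2‖]
    have h2 : ‖τ.2‖ = 0 := by nlinarith [sq_nonneg ‖τ.1‖, sq_nonneg ‖τ.2‖]
    exact hne (Prod.ext (norm_eq_zero.1 h1) (norm_eq_zero.1 h2))
  have hk : ∀ k : ℕ, ‖h (k • τ)‖ = ‖h 0‖ := fun k => by
    induction k with
    | zero => rw [zero_smul]
    | succ k ih => rw [succ_nsmul, hτ, ih]
  have hlim : Tendsto (fun k : ℕ => C * Real.exp (-(ε * (‖τ.1‖ ^ 2 + ‖τ.2‖ ^ 2) * (k : ℝ) ^ 2)))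
      atTop (𝓝 (C * 0)) := by
    refine Tendsto.const_mul C (Real.tendsto_exp_neg_atTop_nhds_zero.comp ?_)
    exact ((tendsto_pow_atTop two_ne_zero).comp tendsto_natCast_atTop_atTop).const_mul_atTop
      (mul_pos hε hpos)
  have hle : ‖h 0‖ ≤ C * 0 := by
    refine ge_of_tendsto' hlim fun k => ?_
    rw [← hk k]
    refine (hC _).trans_eq ?_
    have h1 : ‖(k • τ).1‖ = k * ‖τ.1‖ := by rw [Prod.smul_fst, RCLike.norm_nsmul ℝ, nsmul_eq_mul]
    have h2 : ‖(k • τ).2‖ = k * ‖τ.2‖ := by rw [Prod.smul_snd, RCLike.norm_nsmul ℝ, nsmul_eq_mul]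
    rw [h1, h2]
    ring_nf
  rw [mul_zero] at hle
  exact h0 (norm_le_zero_iff.1 hle)

/-- The matrix is determined by the matrix-Wigner distribution. -/
theorem eq_of_matrixWigner_eq (hA : A.det ≠ 0) (hB : B.det ≠ 0)
    (h : ∀ f g : M1 (Fin d), M1.wigner hA f g = M1.wigner hB f g) : A = B := by
  obtain ⟨C, ε, hε, hC⟩ := exists_norm_stft_wignerGauss_le hA
  have hG : M1.wignerGauss hB = M1.wignerGauss hA := (h _ _).symm
  -- Both sides are unimodular multiples of shifts of the same function `B_A(φ, φ)`. If the shifts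
  -- differed, the modulus of its short-time Fourier transform would have a nonzero period.
  have hshift : ∀ s, wignerShift A s = wignerShift B s := fun s => by
    have h1 := h ((M1.gauss (Fin d)).tfShift s.1) ((M1.gauss (Fin d)).tfShift s.2)
    rw [M1.wigner_tfShift_gauss, M1.wigner_tfShift_gauss, hG] at h1
    have h2 : ∀ p, ‖stft (wignerGauss A) (p - wignerShift A s)‖ =
        ‖stft (wignerGauss A) (p - wignerShift B s)‖ := fun p => by
      have h3 : stft (wignerPhase A s • tfShift (wignerShift A s) (wignerGauss A)) p =
          stft (wignerPhase B s • tfShift (wignerShift B s) (wignerGauss A)) p :=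
        congrArg (fun F : M1 (Fin d ⊕ Fin d) => stft F.toFun p) h1
      have h4 := congrArg norm h3
      rwa [stft_smul, stft_smul, Pi.smul_apply, Pi.smul_apply, norm_smul, norm_smul,
        norm_wignerPhase, norm_wignerPhase, one_mul, one_mul, norm_stft_tfShift,
        norm_stft_tfShift] at h4
    rw [eq_comm, ← sub_eq_zero]
    refine eq_zero_of_periodic hε hC (stft_wignerGauss_zero_ne_zero hA) fun p => ?_
    have h5 := h2 (p + wignerShift B s)
    rw [add_sub_cancel_right] at h5
    rw [← h5, add_sub_assoc]
  -- Pure modulations suffice: with frequencies `w.fst` and `-w.snd` the frequency part of the shift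
  -- is `Aᵀ w`.
  have hT : ∀ w : Phase d, matMap A.transpose w = matMap B.transpose w := fun w => by
    have h1 := hshift ((0, w.fst), (0, -w.snd))
    have h2 : freqShift A ((0, w.fst), (0, -w.snd)) = freqShift B ((0, w.fst), (0, -w.snd)) :=
      ext_fst_snd (congrArg (fun r : Phase d × Phase d => r.2.fst) h1)
        (congrArg (fun r : Phase d × Phase d => r.1.snd) h1)
    rwa [freqShift, freqShift, neg_neg, pair_fst_snd] at h2
  exact Matrix.transpose_injective (Matrix.toEuclideanLin.injective (LinearMap.ext hT))

theorem swapMatrix_mul_mul_reflMatrix (A : Matrix (Fin d ⊕ Fin d) (Fin d ⊕ Fin d) ℝ) :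
    swapMatrix d * A * reflMatrix d =
      Matrix.fromBlocks A.toBlocks₂₁ (-A.toBlocks₂₂) A.toBlocks₁₁ (-A.toBlocks₁₂) := by
  conv_lhs => rw [← Matrix.fromBlocks_toBlocks A]
  simp [swapMatrix, reflMatrix, Matrix.fromBlocks_multiply]

theorem det_swapMatrix_ne_zero : (swapMatrix d).det ≠ 0 := by
  have h : swapMatrix d * swapMatrix d = 1 := by
    simp [swapMatrix, Matrix.fromBlocks_multiply]
  intro h0
  have h1 := congrArg Matrix.det h
  rw [Matrix.det_mul, h0, zero_mul, Matrix.det_one] at h1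
  exact zero_ne_one h1

theorem det_reflMatrix_ne_zero : (reflMatrix d).det ≠ 0 := by
  have h : reflMatrix d * reflMatrix d = 1 := by
    simp [reflMatrix, Matrix.fromBlocks_multiply]
  intro h0
  have h1 := congrArg Matrix.det h
  rw [Matrix.det_mul, h0, zero_mul, Matrix.det_one] at h1
  exact zero_ne_one h1

theorem fromBlocks_eq_self_iff (A : Matrix (Fin d ⊕ Fin d) (Fin d ⊕ Fin d) ℝ) :
    Matrix.fromBlocks A.toBlocks₂₁ (-A.toBlocks₂₂) A.toBlocks₁₁ (-A.toBlocks₁₂) = A ↔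
      A.toBlocks₂₁ = A.toBlocks₁₁ ∧ A.toBlocks₁₂ = -A.toBlocks₂₂ := by
  conv_lhs => rhs; rw [← Matrix.fromBlocks_toBlocks A]
  rw [Matrix.fromBlocks_inj]
  constructor
  · rintro ⟨h1, h2, -, -⟩
    exact ⟨h1, h2.symm⟩
  · rintro ⟨h1, h2⟩
    exact ⟨h1, h2.symm, h1.symm, by rw [h2, neg_neg]⟩

theorem adj_quantize_eq_self_iff (hA : A.det ≠ 0)
    (hBA : Matrix.fromBlocks A.toBlocks₂₁ (-A.toBlocks₂₂) A.toBlocks₁₁ (-A.toBlocks₁₂) = A)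
    (σ : MInfty (Fin d ⊕ Fin d)) : (quantize A σ).adj = quantize A σ ↔ σ.conj = σ := by
  rw [adj_quantize hA hA hBA.symm, (quantize_injective hA).eq_iff]

/-- Point evaluations are real symbols. Self-adjointness for them says that the quantizations by `B`
and `A` agree, that is, the two matrix-Wigner distributions agree at every point. -/
theorem eq_of_adj_quantize_eq_self (hA : A.det ≠ 0) (hB : B.det ≠ 0)
    (hBA : B = Matrix.fromBlocks A.toBlocks₂₁ (-A.toBlocks₂₂) A.toBlocks₁₁ (-A.toBlocks₁₂))
    (h : ∀ σ : MInfty (Fin d ⊕ Fin d), σ.conj = σ → (quantize A σ).adj = quantize A σ) :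
    B = A := by
  refine (eq_of_matrixWigner_eq hA hB fun f g => M1.ext' (funext fun z => ?_)).symm
  have h1 := h (MInfty.eval z) (MInfty.conj_eval z)
  rw [adj_quantize hA hB hBA, MInfty.conj_eval] at h1
  have h2 : quantize B (MInfty.eval z) g f = quantize A (MInfty.eval z) g f := by rw [h1]
  rw [quantize_apply hA, quantize_apply hB] at h2
  exact ((starRingEnd ℂ).injective h2).symm

end Quantization

end

theorem mainTheorem4 (d : ℕ) (A B : Matrix (Fin d ⊕ Fin d) (Fin d ⊕ Fin d) ℝ)
    (hA : A.det ≠ 0) (hB : B = swapMatrix d * A * reflMatrix d) :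
    -- the block form of `B`, its invertibility, and the meaning of `B = A`
    (B = Matrix.fromBlocks A.toBlocks₂₁ (-A.toBlocks₂₂) A.toBlocks₁₁ (-A.toBlocks₁₂) ∧
      B.det ≠ 0 ∧
      (B = A ↔ A.toBlocks₂₁ = A.toBlocks₁₁ ∧ A.toBlocks₁₂ = -A.toBlocks₂₂)) ∧
    -- `σ^A` and `ρ^B` are well defined for all symbols, and `(σ^A)* = ρ^B` with `ρ = conj σ`
    (∀ σ : MInfty (Fin d ⊕ Fin d),
      IsQuantization A σ (quantize A σ) ∧
      IsQuantization B σ.conj (quantize B σ.conj) ∧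
      (quantize A σ).adj = quantize B σ.conj) ∧
    -- the self-adjoint operators of the calculus are exactly those with real symbol
    -- if and only if `B = A`
    ((∀ σ : MInfty (Fin d ⊕ Fin d), (quantize A σ).adj = quantize A σ ↔ σ.conj = σ) ↔
      A.toBlocks₂₁ = A.toBlocks₁₁ ∧ A.toBlocks₁₂ = -A.toBlocks₂₂) ∧
    -- already the self-adjointness of `σ^A` for all real `σ` forces `B = A`
    ((∀ σ : MInfty (Fin d ⊕ Fin d), σ.conj = σ → (quantize A σ).adj = quantize A σ) ↔
      A.toBlocks₂₁ = A.toBlocks₁₁ ∧ A.toBlocks₁₂ = -A.toBlocks₂₂) := by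
  have hdet : B.det ≠ 0 := by
    rw [hB, Matrix.det_mul, Matrix.det_mul]
    exact mul_ne_zero (mul_ne_zero det_swapMatrix_ne_zero hA) det_reflMatrix_ne_zero
  rw [swapMatrix_mul_mul_reflMatrix] at hB
  have hiff : B = A ↔ A.toBlocks₂₁ = A.toBlocks₁₁ ∧ A.toBlocks₁₂ = -A.toBlocks₂₂ := by
    rw [hB]
    exact fromBlocks_eq_self_iff A
  refine ⟨⟨hB, hdet, hiff⟩, fun σ => ⟨isQuantization_quantize hA σ,
    isQuantization_quantize hdet σ.conj, adj_quantize hA hdet hB σ⟩, ⟨fun h => ?_, fun h σ => ?_⟩,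
    ⟨fun h => ?_, fun h σ hσ => ?_⟩⟩
  -- Only the implication from real symbol to self-adjoint operator is needed.
  · exact hiff.1 (eq_of_adj_quantize_eq_self hA hdet hB fun σ => (h σ).2)
  · exact adj_quantize_eq_self_iff hA ((fromBlocks_eq_self_iff A).2 h) σ
  · exact hiff.1 (eq_of_adj_quantize_eq_self hA hdet hB h)
  · exact (adj_quantize_eq_self_iff hA ((fromBlocks_eq_self_iff A).2 h) σ).2 hσ
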